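/- Let $\theta>0$ and $y_0\in(0,\tfrac12)$. Consider the autonomous system for $(Q_1,Q_2,\Lambda,u)(s)\in\mathbb R^4$ $$\frac{dQ_i}{ds}=-\frac{e^{u}Q_i\zeta_i}{D_i}\quad(i=1,2),$$ $$e^{-2\Lambda}(2\Lambda_s-1)+1=\frac{\theta}{2}\sum_{i=1}^{2}\frac{Q_i^2(\zeta_i^2+1)}{|D_i|},\qquad e^{-2\Lambda}(2u_s+3)-1=\frac{\theta}{2}\sum_{i=1}^{2}\frac{Q_i^2\zeta_i^2}{|D_i|},$$ where $D_i=\zeta_ie^{u}+y_0e^{\Lambda}\sqrt{\zeta_i^2+1}$ and $\zeta_1<\zeta_2$ are the two roots of $e^{u}\sqrt{\zeta^2+1}+y_0\zeta e^{\Lambda}=\sqrt{1-y_0^2}$; the phase space is the open set of those $(Q_1,Q_2,\Lambda,u)$ for which two distinct roots exist. **Theorem.** The point $P_1=\Bigl(0,\ \dfrac{2\sqrt{y_0}}{3^{1/4}\sqrt\theta},\ \dfrac{\log 3}{2},\ \log\sqrt{1-y_0^2}\Bigr)$ is a steady state of this system and a hyperbolic saddle. The eigenvalues of the linearisation at $P_1$,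 counted with algebraic multiplicity, are $$\gamma_1=-\frac{2(1-y_0^2)}{1-4y_0^2}<0,\quad \gamma_2=-2<0,\quad \gamma_3=-\frac{\sqrt{1-y_0^2}}{y_0}<0,\quad \gamma_4=\frac{\sqrt{1-y_0^2}}{y_0}>0,$$ with corresponding eigenvectors $$v_1=\begin{pmatrix}1\\0\\0\\0\end{pmatrix},\quad v_2=\begin{pmatrix}0\\-\frac{1-y_0^2}{3^{5/4}y_0^{3/2}\sqrt\theta}\\-\frac23\\1\end{pmatrix},\quad v_3=\begin{pmatrix}0\\-\frac{2\sqrt{1-y_0^2}}{3^{5/4}y_0^{1/2}\sqrt\theta}\\-\frac{\sqrt{1-y_0^2}}{3y_0}\\1\end{pmatrix},\quad v_4=\begin{pmatrix}0\\\frac{2\sqrt{1-y_0^2}}{3^{5/4}y_0^{1/2}\sqrt\theta}\\\frac{\sqrt{1-y_0^2}}{3y_0}\\1\end{pmatrix}.$$ Let $\mathcal M_\theta$ be the stable manifold of $P_1$, that is, the set of initial data of solutions which exist for all $s\ge0$ and converge to $P_1$ as $s\to\infty$. Then $\mathcal M_\theta$ is a three-dimensional $C^\infty$ manifold whose tangent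 space at $P_1$ is $\operatorname{span}\{v_1,v_2,v_3\}$ if $y_0\ne 1/\sqrt5$. In the exceptional case $y_0=1/\sqrt5$, where $\gamma_2=\gamma_3$ and $v_2=v_3$, the tangent space is $\operatorname{span}\{v_1,v_2,w\}$ with the generalised eigenvector $$w=\Bigl(0,\ -\frac{\sqrt{1-y_0^2}}{3^{1/4}y_0^{1/2}\sqrt\theta},\ 1,\ 0\Bigr)^{T}.$$ More precisely, there are arbitrarily small open neighbourhoods $U$ of $P_1$ such that, writing $\mathcal M_T$ $(T\ge0)$ for the set of initial data of the solutions as above that lie in $U$ for all $s\ge T$ (so that $\mathcal M_0$ is the local stable manifold in $U$), every $\mathcal M_T$ is a three-dimensional embedded $C^\infty$ submanifold of $\mathbb R^4$ containing $P_1$ and having the stated tangent space at $P_1$, $\mathcal M_T$ is a relatively open subset of $\mathcal M_{T'}$ for $T\le T'$, and $\mathcal M_\theta=\bigcup_{T\ge0}\mathcal M_T$. -/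

import Mathlib

open Set Filter Topology
open scoped ContDiff

/-!
Points of the four-dimensional phase space are `x = (Q₁, Q₂, Λ, u) : Fin 4 → ℝ`.
-/

noncomputable section

/-- The algebraic relation `e^u √(ζ²+1) + y₀ ζ e^Λ = √(1-y₀²)`. -/
def ZetaRelation (y₀ Λ u ζ : ℝ) : Prop :=
  Real.exp u * √(ζ ^ 2 + 1) + y₀ * ζ * Real.exp Λ = √(1 - y₀ ^ 2)

/-- The quantity `ζ e^u + y₀ e^Λ √(ζ²+1)` occurring in the denominators. -/
def zetaDenom (y₀ Λ u ζ : ℝ) : ℝ :=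
  ζ * Real.exp u + y₀ * Real.exp Λ * √(ζ ^ 2 + 1)

/-- The reduced system, at a point `x = (Q₁, Q₂, Λ, u)` of phase space and with
`v = (dQ₁/ds, dQ₂/ds, dΛ/ds, du/ds)`. -/
def ReducedSystem (y₀ θ : ℝ) (x v : Fin 4 → ℝ) : Prop :=
  ∃ ζ₁ ζ₂ : ℝ, ζ₁ < ζ₂ ∧ ZetaRelation y₀ (x 2) (x 3) ζ₁ ∧ ZetaRelation y₀ (x 2) (x 3) ζ₂ ∧
    v 0 = -(Real.exp (x 3) * x 0 * ζ₁ / zetaDenom y₀ (x 2) (x 3) ζ₁) ∧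
    v 1 = -(Real.exp (x 3) * x 1 * ζ₂ / zetaDenom y₀ (x 2) (x 3) ζ₂) ∧
    Real.exp (-2 * x 2) * (2 * v 2 - 1) + 1 =
      θ / 2 * (x 0 ^ 2 * (ζ₁ ^ 2 + 1) / |zetaDenom y₀ (x 2) (x 3) ζ₁| +
        x 1 ^ 2 * (ζ₂ ^ 2 + 1) / |zetaDenom y₀ (x 2) (x 3) ζ₂|) ∧
    Real.exp (-2 * x 2) * (2 * v 3 + 3) - 1 =
      θ / 2 * (x 0 ^ 2 * ζ₁ ^ 2 / |zetaDenom y₀ (x 2) (x 3) ζ₁| +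
        x 1 ^ 2 * ζ₂ ^ 2 / |zetaDenom y₀ (x 2) (x 3) ζ₂|)

/-- `√(1 - y₀² - e^{2u} + y₀² e^{2Λ})`, the common absolute value of the two denominators. -/
def zetaDisc (y₀ Λ u : ℝ) : ℝ :=
  √(1 - y₀ ^ 2 - Real.exp u ^ 2 + (y₀ * Real.exp Λ) ^ 2)

/-- The smaller root of `ZetaRelation`. -/
def zetaOne (y₀ Λ u : ℝ) : ℝ :=
  (-(y₀ * Real.exp Λ * √(1 - y₀ ^ 2)) - Real.exp u * zetaDisc y₀ Λ u) /
    (Real.exp u ^ 2 - (y₀ * Real.exp Λ) ^ 2)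

/-- The larger root of `ZetaRelation`. -/
def zetaTwo (y₀ Λ u : ℝ) : ℝ :=
  (-(y₀ * Real.exp Λ * √(1 - y₀ ^ 2)) + Real.exp u * zetaDisc y₀ Λ u) /
    (Real.exp u ^ 2 - (y₀ * Real.exp Λ) ^ 2)

/-- The open set of phase space on which `ZetaRelation` has two distinct roots. -/
def phaseDomain (y₀ : ℝ) : Set (Fin 4 → ℝ) :=
  {x | y₀ * Real.exp (x 2) < Real.exp (x 3) ∧
    Real.exp (x 3) ^ 2 - (y₀ * Real.exp (x 2)) ^ 2 < 1 - y₀ ^ 2}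

/-- The vector field of the reduced system: the system solved for the derivatives
(see `reducedSystem_iff`). -/
def reducedField (y₀ θ : ℝ) (x : Fin 4 → ℝ) : Fin 4 → ℝ :=
  let ζ₁ := zetaOne y₀ (x 2) (x 3)
  let ζ₂ := zetaTwo y₀ (x 2) (x 3)
  let D := zetaDisc y₀ (x 2) (x 3)
  ![Real.exp (x 3) * x 0 * ζ₁ / D,
    -(Real.exp (x 3) * x 1 * ζ₂ / D),
    (1 + Real.exp (2 * x 2) *
      (θ / 2 * (x 0 ^ 2 * (ζ₁ ^ 2 + 1) / D + x 1 ^ 2 * (ζ₂ ^ 2 + 1) / D) - 1)) / 2,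
    (Real.exp (2 * x 2) *
      (θ / 2 * (x 0 ^ 2 * ζ₁ ^ 2 / D + x 1 ^ 2 * ζ₂ ^ 2 / D) + 1) - 3) / 2]

/-- The roots of `a √(ζ²+1) + b ζ = c` when there are two of them. -/
theorem two_roots_of_lt {a b c ζ₁ ζ₂ : ℝ} (ha : 0 < a) (hb : 0 < b) (hlt : ζ₁ < ζ₂)
    (h₁ : a * √(ζ₁ ^ 2 + 1) + b * ζ₁ = c) (h₂ : a * √(ζ₂ ^ 2 + 1) + b * ζ₂ = c) :
    b < a ∧ a ^ 2 - b ^ 2 < c ^ 2 ∧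
      ζ₁ * a + b * √(ζ₁ ^ 2 + 1) = -√(c ^ 2 - a ^ 2 + b ^ 2) ∧
      ζ₂ * a + b * √(ζ₂ ^ 2 + 1) = √(c ^ 2 - a ^ 2 + b ^ 2) ∧
      ζ₁ = (-(b * c) - a * √(c ^ 2 - a ^ 2 + b ^ 2)) / (a ^ 2 - b ^ 2) ∧
      ζ₂ = (-(b * c) + a * √(c ^ 2 - a ^ 2 + b ^ 2)) / (a ^ 2 - b ^ 2) := by
  obtain ⟨S₁, hS₁⟩ : ∃ S, S = √(ζ₁ ^ 2 + 1) := ⟨_, rfl⟩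
  obtain ⟨S₂, hS₂⟩ : ∃ S, S = √(ζ₂ ^ 2 + 1) := ⟨_, rfl⟩
  have e₁ : S₁ ^ 2 = ζ₁ ^ 2 + 1 := by rw [hS₁, Real.sq_sqrt (by positivity)]
  have e₂ : S₂ ^ 2 = ζ₂ ^ 2 + 1 := by rw [hS₂, Real.sq_sqrt (by positivity)]
  have p₁ : 0 < S₁ := by rw [hS₁]; positivity
  have p₂ : 0 < S₂ := by rw [hS₂]; positivity
  rw [← hS₁] at h₁ ⊢
  rw [← hS₂] at h₂ ⊢
  have hdiff : a * (S₁ - S₂) = b * (ζ₂ - ζ₁) := by linarith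
  have hpos : 0 < S₁ - S₂ := by
    have : 0 < a * (S₁ - S₂) := by rw [hdiff]; exact mul_pos hb (by linarith)
    exact (mul_pos_iff_of_pos_left ha).1 this
  have hfac : (S₁ - S₂) * (S₁ + S₂) = (ζ₁ - ζ₂) * (ζ₁ + ζ₂) := by nlinarith
  have hlt' : S₁ - S₂ < ζ₂ - ζ₁ := by
    have a₁ : -ζ₁ < S₁ := by nlinarith [sq_nonneg (S₁ + ζ₁)]
    have a₂ : -ζ₂ < S₂ := by nlinarith [sq_nonneg (S₂ + ζ₂)]
    by_contra hcon
    push Not at hcon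
    nlinarith [mul_pos (sub_pos.2 hlt) (by linarith : 0 < S₁ + S₂ + ζ₁ + ζ₂),
      mul_nonneg (sub_nonneg.2 hcon) (by linarith : 0 ≤ S₁ + S₂)]
  have hba : b < a := by
    by_contra hcon
    push Not at hcon
    nlinarith [mul_nonneg (sub_nonneg.2 hcon) (by linarith : 0 ≤ ζ₂ - ζ₁)]
  have hab : 0 < a ^ 2 - b ^ 2 := by nlinarith
  obtain ⟨D₁, hD₁⟩ : ∃ D, D = ζ₁ * a + b * S₁ := ⟨_, rfl⟩
  obtain ⟨D₂, hD₂⟩ : ∃ D, D = ζ₂ * a + b * S₂ := ⟨_, rfl⟩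
  rw [← hD₁, ← hD₂]
  have q₁ : D₁ ^ 2 = c ^ 2 - a ^ 2 + b ^ 2 := by
    rw [hD₁, ← h₁]; linear_combination (b ^ 2 - a ^ 2) * e₁
  have q₂ : D₂ ^ 2 = c ^ 2 - a ^ 2 + b ^ 2 := by
    rw [hD₂, ← h₂]; linear_combination (b ^ 2 - a ^ 2) * e₂
  have z₁ : (a ^ 2 - b ^ 2) * ζ₁ = -(b * c) + a * D₁ := by rw [hD₁, ← h₁]; ring
  have z₂ : (a ^ 2 - b ^ 2) * ζ₂ = -(b * c) + a * D₂ := by rw [hD₂, ← h₂]; ring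
  have hDlt : D₁ < D₂ := by
    have := mul_lt_mul_of_pos_left hlt hab
    rw [z₁, z₂] at this
    exact (mul_lt_mul_iff_of_pos_left ha).1 (by linarith)
  have hsum : D₁ = -D₂ := by
    have h0 : (D₂ - D₁) * (D₂ + D₁) = 0 := by nlinarith
    rcases mul_eq_zero.1 h0 with h | h <;> linarith
  have hD₂pos : 0 < D₂ := by linarith
  have hD₂eq : √(c ^ 2 - a ^ 2 + b ^ 2) = D₂ := by
    rw [← q₂, Real.sqrt_sq hD₂pos.le]
  rw [hD₂eq]
  refine ⟨hba, by nlinarith, hsum, rfl, ?_, ?_⟩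
  · rw [eq_div_iff hab.ne']; rw [hsum] at z₁; linarith
  · rw [eq_div_iff hab.ne']; linarith

/-- Conversely, the two explicit numbers are roots of `a √(ζ²+1) + b ζ = c`. -/
theorem roots_are_roots {a b c : ℝ} (hb : 0 < b) (hc : 0 ≤ c) (hba : b < a)
    (hlt : a ^ 2 - b ^ 2 < c ^ 2) (σ : ℝ) (hσ : σ ^ 2 = c ^ 2 - a ^ 2 + b ^ 2) :
    a * √(((-(b * c) + a * σ) / (a ^ 2 - b ^ 2)) ^ 2 + 1) +
      b * ((-(b * c) + a * σ) / (a ^ 2 - b ^ 2)) = c := by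
  have hab : 0 < a ^ 2 - b ^ 2 := by nlinarith
  have hc' : 0 < c := by
    rcases hc.eq_or_lt with h | h
    · rw [← h] at hlt; nlinarith
    · exact h
  have hσc : b * σ ≤ a * c := by
    have h1 : (b * σ) ^ 2 ≤ (a * c) ^ 2 := by
      have e : (a * c) ^ 2 - (b * σ) ^ 2 = (a ^ 2 - b ^ 2) * (c ^ 2 + b ^ 2) := by
        linear_combination (-b ^ 2) * hσ
      have := mul_nonneg hab.le (by positivity : 0 ≤ c ^ 2 + b ^ 2)
      linarith
    exact (abs_le.1 (abs_le_of_sq_le_sq h1 (mul_nonneg (by linarith) hc))).2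
  have hS : ((-(b * c) + a * σ) / (a ^ 2 - b ^ 2)) ^ 2 + 1 =
      ((a * c - b * σ) / (a ^ 2 - b ^ 2)) ^ 2 := by
    rw [div_pow, div_pow, div_add_one (by positivity)]
    congr 1
    linear_combination (a ^ 2 - b ^ 2) * hσ
  rw [hS, Real.sqrt_sq (div_nonneg (by linarith) hab.le)]
  field_simp
  ring

/-- On its domain the reduced system is the ordinary differential equation
`dx/ds = reducedField y₀ θ x`. -/
theorem reducedSystem_iff {y₀ θ : ℝ} (h0 : 0 < y₀) (h1 : y₀ < 1) (x v : Fin 4 → ℝ) :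
    ReducedSystem y₀ θ x v ↔ x ∈ phaseDomain y₀ ∧ v = reducedField y₀ θ x := by
  have hcsq : √(1 - y₀ ^ 2) ^ 2 = 1 - y₀ ^ 2 := Real.sq_sqrt (by nlinarith)
  have hexp : Real.exp (-2 * x 2) * Real.exp (2 * x 2) = 1 := by
    rw [← Real.exp_add]; simp
  have hepos := Real.exp_pos (-2 * x 2)
  have key : ∀ ζ₁ ζ₂ : ℝ, ζ₁ < ζ₂ → ZetaRelation y₀ (x 2) (x 3) ζ₁ →
      ZetaRelation y₀ (x 2) (x 3) ζ₂ →
      x ∈ phaseDomain y₀ ∧ 0 < zetaDisc y₀ (x 2) (x 3) ∧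
      zetaDenom y₀ (x 2) (x 3) ζ₁ = -zetaDisc y₀ (x 2) (x 3) ∧
      zetaDenom y₀ (x 2) (x 3) ζ₂ = zetaDisc y₀ (x 2) (x 3) ∧
      ζ₁ = zetaOne y₀ (x 2) (x 3) ∧ ζ₂ = zetaTwo y₀ (x 2) (x 3) := by
    intro ζ₁ ζ₂ hlt r₁ r₂
    unfold ZetaRelation at r₁ r₂
    obtain ⟨k1, k2, k3, k4, k5, k6⟩ := two_roots_of_lt (a := Real.exp (x 3))
      (b := y₀ * Real.exp (x 2)) (c := √(1 - y₀ ^ 2)) (Real.exp_pos _)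
      (mul_pos h0 (Real.exp_pos _)) hlt (by linarith) (by linarith)
    rw [hcsq] at k2 k3 k4 k5 k6
    refine ⟨⟨k1, k2⟩, Real.sqrt_pos.2 (by linarith), k3, k4, k5, k6⟩
  constructor
  · rintro ⟨ζ₁, ζ₂, hlt, r₁, r₂, e0, e1, e2, e3⟩
    obtain ⟨hx, hD, d₁, d₂, z₁, z₂⟩ := key ζ₁ ζ₂ hlt r₁ r₂
    refine ⟨hx, ?_⟩
    rw [d₁, d₂, abs_neg, abs_of_pos hD] at e2 e3
    rw [d₁] at e0
    rw [d₂] at e1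
    rw [z₁] at e0 e2 e3
    rw [z₂] at e1 e2 e3
    funext i
    fin_cases i
    · simpa [reducedField, div_neg] using e0
    · simpa [reducedField] using e1
    · change v 2 = reducedField y₀ θ x 2
      simp only [reducedField, Matrix.cons_val]
      linear_combination (Real.exp (2 * x 2) / 2) * e2 - (v 2 - 1 / 2) * hexp
    · change v 3 = reducedField y₀ θ x 3
      simp only [reducedField, Matrix.cons_val]
      linear_combination (Real.exp (2 * x 2) / 2) * e3 - (v 3 + 3 / 2) * hexp
  · rintro ⟨hx, rfl⟩
    have hD : 0 < zetaDisc y₀ (x 2) (x 3) := Real.sqrt_pos.2 (by linarith [hx.2])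
    have hDsq : zetaDisc y₀ (x 2) (x 3) ^ 2 =
        √(1 - y₀ ^ 2) ^ 2 - Real.exp (x 3) ^ 2 + (y₀ * Real.exp (x 2)) ^ 2 := by
      rw [hcsq]; exact Real.sq_sqrt (by linarith [hx.2])
    have hpb := mul_pos h0 (Real.exp_pos (x 2))
    have hab : 0 < Real.exp (x 3) ^ 2 - (y₀ * Real.exp (x 2)) ^ 2 := by
      nlinarith [hx.1]
    have r₁ : ZetaRelation y₀ (x 2) (x 3) (zetaOne y₀ (x 2) (x 3)) := by
      have := roots_are_roots hpb (Real.sqrt_nonneg (1 - y₀ ^ 2)) hx.1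
        (by rw [hcsq]; exact hx.2) (-zetaDisc y₀ (x 2) (x 3)) (by rw [neg_sq]; exact hDsq)
      rw [mul_neg, ← sub_eq_add_neg] at this
      unfold ZetaRelation
      rw [mul_right_comm]
      exact this
    have r₂ : ZetaRelation y₀ (x 2) (x 3) (zetaTwo y₀ (x 2) (x 3)) := by
      have := roots_are_roots hpb (Real.sqrt_nonneg (1 - y₀ ^ 2)) hx.1
        (by rw [hcsq]; exact hx.2) (zetaDisc y₀ (x 2) (x 3)) hDsq
      unfold ZetaRelation
      rw [mul_right_comm]
      exact this
    have hlt : zetaOne y₀ (x 2) (x 3) < zetaTwo y₀ (x 2) (x 3) := by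
      unfold zetaOne zetaTwo
      rw [div_lt_div_iff_of_pos_right hab]
      have := mul_pos (Real.exp_pos (x 3)) hD
      linarith
    obtain ⟨-, -, d₁, d₂, -, -⟩ := key _ _ hlt r₁ r₂
    refine ⟨_, _, hlt, r₁, r₂, ?_, ?_, ?_, ?_⟩
    · rw [d₁]; simp [reducedField, div_neg]
    · rw [d₂]; simp [reducedField]
    · rw [d₁, d₂, abs_neg, abs_of_pos hD]
      simp only [reducedField, Matrix.cons_val]
      linear_combination (θ / 2 * (x 0 ^ 2 * (zetaOne y₀ (x 2) (x 3) ^ 2 + 1) /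
        zetaDisc y₀ (x 2) (x 3) + x 1 ^ 2 * (zetaTwo y₀ (x 2) (x 3) ^ 2 + 1) /
        zetaDisc y₀ (x 2) (x 3)) - 1) * hexp
    · rw [d₁, d₂, abs_neg, abs_of_pos hD]
      simp only [reducedField, Matrix.cons_val]
      linear_combination (θ / 2 * (x 0 ^ 2 * zetaOne y₀ (x 2) (x 3) ^ 2 /
        zetaDisc y₀ (x 2) (x 3) + x 1 ^ 2 * zetaTwo y₀ (x 2) (x 3) ^ 2 /
        zetaDisc y₀ (x 2) (x 3)) + 1) * hexp

/-- The steady state `P₁ = (Q₁, Q₂, Λ, u)`. -/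
def steadyState (y₀ θ : ℝ) : Fin 4 → ℝ :=
  ![0, 2 * √y₀ / ((3 : ℝ) ^ (1 / 4 : ℝ) * √θ), Real.log 3 / 2, Real.log √(1 - y₀ ^ 2)]

/-- `p` is a hyperbolic saddle of `dx/ds = f x`: an equilibrium at which the linearisation has
no eigenvalue on the imaginary axis, and eigenvalues on both sides of it. -/
def IsHyperbolicSaddle (f : (Fin 4 → ℝ) → (Fin 4 → ℝ)) (p : Fin 4 → ℝ) : Prop :=
  f p = 0 ∧ DifferentiableAt ℝ f p ∧
  (∀ z : ℂ, Polynomial.aeval z (fderiv ℝ f p).toLinearMap.charpoly = 0 → z.re ≠ 0) ∧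
  (∃ z : ℂ, Polynomial.aeval z (fderiv ℝ f p).toLinearMap.charpoly = 0 ∧ z.re < 0) ∧
  (∃ z : ℂ, Polynomial.aeval z (fderiv ℝ f p).toLinearMap.charpoly = 0 ∧ 0 < z.re)

/-- `γ` restricted to `[0, ∞)` is a solution of the reduced system. -/
def IsForwardSolution (y₀ θ : ℝ) (γ : ℝ → Fin 4 → ℝ) : Prop :=
  ∀ s : ℝ, 0 ≤ s → ∃ v, HasDerivWithinAt γ v (Ici 0) s ∧ ReducedSystem y₀ θ (γ s) v

/-- The (global) stable manifold of `P₁` as a set: the initial data of the solutions which exist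
for all `s ≥ 0` and converge to `P₁`. -/
def stableSet (y₀ θ : ℝ) : Set (Fin 4 → ℝ) :=
  {x | ∃ γ : ℝ → Fin 4 → ℝ, IsForwardSolution y₀ θ γ ∧ γ 0 = x ∧
    Tendsto γ atTop (𝓝 (steadyState y₀ θ))}

/-- The part of the stable manifold whose orbits stay in `U` from the time `T` on. For `T = 0`
this is the local stable manifold in `U`. -/
def stableSetFrom (y₀ θ : ℝ) (U : Set (Fin 4 → ℝ)) (T : ℝ) : Set (Fin 4 → ℝ) :=
  {x | ∃ γ : ℝ → Fin 4 → ℝ, IsForwardSolution y₀ θ γ ∧ γ 0 = x ∧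
    Tendsto γ atTop (𝓝 (steadyState y₀ θ)) ∧ ∀ s, T ≤ s → γ s ∈ U}

/-- `S` is an embedded `C^∞` submanifold of `ℝⁿ` of dimension `k`: near each of its points a
`C^∞` diffeomorphism between open sets straightens it to `ℝᵏ × {0}`. -/
def IsSmoothSubmanifold {n : ℕ} (k : ℕ) (S : Set (Fin n → ℝ)) : Prop :=
  k ≤ n ∧ ∀ x ∈ S, ∃ Φ : OpenPartialHomeomorph (Fin n → ℝ) (Fin n → ℝ), x ∈ Φ.source ∧
    ContDiffOn ℝ ∞ Φ Φ.source ∧ ContDiffOn ℝ ∞ Φ.symm Φ.target ∧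
    ∀ y ∈ Φ.source, y ∈ S ↔ ∀ i : Fin n, k ≤ (i : ℕ) → Φ y i = 0

/-- The vectors tangent to `S` at `p`: the velocities at `p` of the curves in `S`. -/
def tangentVectors {n : ℕ} (S : Set (Fin n → ℝ)) (p : Fin n → ℝ) : Set (Fin n → ℝ) :=
  {v | ∃ c : ℝ → Fin n → ℝ, c 0 = p ∧ HasDerivAt c v 0 ∧ ∀ᶠ t in 𝓝 (0 : ℝ), c t ∈ S}

/-- The four eigenvalues of the linearisation. -/
def eigval (y₀ : ℝ) : Fin 4 → ℝ :=
  ![-(2 * (1 - y₀ ^ 2) / (1 - 4 * y₀ ^ 2)), -2, -(√(1 - y₀ ^ 2) / y₀), √(1 - y₀ ^ 2) / y₀]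

/-- The corresponding eigenvectors. -/
def eigvec (y₀ θ : ℝ) : Fin 4 → (Fin 4 → ℝ) :=
  ![![1, 0, 0, 0],
    ![0, -((1 - y₀ ^ 2) / ((3 : ℝ) ^ (5 / 4 : ℝ) * y₀ ^ (3 / 2 : ℝ) * √θ)), -(2 / 3), 1],
    ![0, -(2 * √(1 - y₀ ^ 2) / ((3 : ℝ) ^ (5 / 4 : ℝ) * √y₀ * √θ)),
      -(√(1 - y₀ ^ 2) / (3 * y₀)), 1],
    ![0, 2 * √(1 - y₀ ^ 2) / ((3 : ℝ) ^ (5 / 4 : ℝ) * √y₀ * √θ),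
      √(1 - y₀ ^ 2) / (3 * y₀), 1]]

/-- A generalised eigenvector for the eigenvalue `-2` in the resonant case `y₀ = 1/√5`, in which
the second and third eigenvalues and eigenvectors coincide. -/
def resonantVec (y₀ θ : ℝ) : Fin 4 → ℝ :=
  ![0, -(√(1 - y₀ ^ 2) / ((3 : ℝ) ^ (1 / 4 : ℝ) * √y₀ * √θ)), 1, 0]

end

/-!
Where the relation defining `ζ₁, ζ₂` has two distinct roots, the reduced system is the autonomous
equation of the `C^∞` field `reducedField` (`reducedSystem_iff`). At the steady state `Q₁ = 0`, and
`Q₁` enters the other equations quadratically, so its direction decouples from the linearisation.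
The remaining three-dimensional block is explicit in terms of `rate y₀ = √(1 - y₀²) / y₀` and the
second coordinate `steadyQ` of the steady state (`fderiv_reducedField`).

*Linear algebra.* The vector `w = resonantVec` satisfies `v₃ = v₂ + ((2 - rate) / 3) w`. In the
basis `v₁, v₂, w / 4, v₄` the linearisation is therefore upper triangular, with diagonal `eigval` and
a single off-diagonal entry `3 / 4`, whether or not the second and third eigenvalues coincide
(`fderiv_nearEigenbasis`). This yields the characteristic polynomial, and treats the resonant value
`y₀ = 1 / √5` together with all others: the stable subspace is always the span of `v₁, v₂, w`, which
is the span of `v₁, v₂, v₃` without resonance. The entry `3 / 4` is smaller than the spectral gap,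
since `rate y₀ > 1`, so it may be counted as part of the Lipschitz perturbation.

*The local stable manifold* is obtained by Perron's method. A bounded function on `[0, ∞)` solves
`z' = l * z + g z`, with `l` diagonal and hyperbolic, if and only if it is a fixed point of
`γ ↦ exp (t l) x + K (g ∘ γ)`, where `x` is a vector in the stable directions and the operator `K`
selects the bounded solution of the linear equation (`duhamel`). Superposition `γ ↦ g ∘ γ` is smooth
on the space of bounded continuous functions on the line when `g` is smooth on a finite-dimensional
space, since bounded functions take values in compact sets (`contDiff_nemytskii`). When `g` has
small Lipschitz constant the fixed point is unique and depends smoothly on `x`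
(`exists_contDiff_fixedPoint`), and it decays exponentially because the contraction preserves the
closed set of functions with that decay (`exists_bounded_solutions`). The values at `t = 0` of these
fixed points form a graph over the stable directions, which a global diffeomorphism straightens.
The neighbourhood `U` is a small ball in linear coordinates; that the orbit stays in `U` is then the
condition `‖Γ x‖ < r` on the fixed point `Γ x`, which is open in `x`
(`exists_local_stable_manifold`).

*Larger times.* The solutions that lie in `U` after time `T` are those whose value at time `T` lies
in the local stable manifold. Near each such initial value the flow up to time `T` is the
restriction of a diffeomorphism of the whole space (`exists_flowBox`), whose smoothness comes from
the same fixed point argument in an exponentially weighted space. Hence these sets are submanifolds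
too (`exists_mem_stableSetIn_iff`), and continuous dependence on the initial value on compact time
intervals makes each of them relatively open in the later ones
(`exists_isOpen_stableSetIn_eq_inter`), so that they share one tangent space at the steady state.
-/

/-! ### Superposition operators on bounded continuous functions -/

open scoped BoundedContinuousFunction

section Nemytskii

variable {α E F : Type*} [TopologicalSpace α] [NormedAddCommGroup E] [ProperSpace E]
  [NormedAddCommGroup F]

theorem exists_bound_comp_boundedContinuousFunction (g : C(E, F)) (γ : α →ᵇ E) :
    ∃ C, ∀ t, ‖g (γ t)‖ ≤ C := by
  obtain ⟨C, hC⟩ := (isCompact_closedBall (0 : E) ‖γ‖).exists_bound_of_continuousOn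
    g.continuous.continuousOn
  exact ⟨C, fun t => hC _ (by simpa using γ.norm_coe_le_norm t)⟩

/-- The superposition operator `γ ↦ g ∘ γ` on bounded continuous functions with values in a
proper space. -/
noncomputable def nemytskii (g : C(E, F)) (γ : α →ᵇ E) : α →ᵇ F :=
  .ofNormedAddCommGroup (fun t => g (γ t)) (g.continuous.comp γ.continuous)
    (exists_bound_comp_boundedContinuousFunction g γ).choose
    (exists_bound_comp_boundedContinuousFunction g γ).choose_spec

@[simp]
theorem nemytskii_apply (g : C(E, F)) (γ : α →ᵇ E) (t : α) : nemytskii g γ t = g (γ t) := rfl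

theorem continuous_nemytskii (g : C(E, F)) :
    Continuous (nemytskii g : (α →ᵇ E) → (α →ᵇ F)) := by
  rw [continuous_iff_continuousAt]
  intro γ
  rw [Metric.continuousAt_iff]
  intro ε hε
  have hu := (isCompact_closedBall (0 : E) (‖γ‖ + 1)).uniformContinuousOn_of_continuous
    g.continuous.continuousOn
  obtain ⟨δ, hδ, h⟩ := Metric.uniformContinuousOn_iff.1 hu (ε / 2) (by positivity)
  refine ⟨min δ 1, by positivity, fun {η} hη => ?_⟩
  refine lt_of_le_of_lt ((BoundedContinuousFunction.dist_le (by positivity)).2 fun t => ?_)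
    (half_lt_self hε)
  have h1 : dist (η t) (γ t) < min δ 1 := (BoundedContinuousFunction.dist_coe_le_dist t).trans_lt hη
  have h2 : ‖γ t‖ ≤ ‖γ‖ := γ.norm_coe_le_norm t
  refine (h _ ?_ _ ?_ (h1.trans_le (min_le_left _ _))).le
  · rw [mem_closedBall_zero_iff]
    have := norm_le_norm_add_norm_sub' (η t) (γ t)
    rw [← dist_eq_norm] at this
    linarith [h1.trans_le (min_le_right _ _)]
  · rw [mem_closedBall_zero_iff]; linarith

theorem norm_nemytskii_sub_le (g : C(E, F)) {q : NNReal} (hg : LipschitzWith q g) (γ η : α →ᵇ E) :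
    ‖nemytskii g γ - nemytskii g η‖ ≤ q * ‖γ - η‖ := by
  rw [BoundedContinuousFunction.norm_le (by positivity)]
  intro t
  calc ‖g (γ t) - g (η t)‖ ≤ q * ‖γ t - η t‖ := hg.norm_sub_le _ _
    _ ≤ q * ‖γ - η‖ := by
      gcongr
      exact (γ - η).norm_coe_le_norm t

/-- Pointwise application of a bounded continuous family of operators, as a bilinear map. -/
noncomputable def pointwiseApply (α E F : Type*) [TopologicalSpace α]
    [NormedAddCommGroup E] [NormedSpace ℝ E] [NormedAddCommGroup F] [NormedSpace ℝ F] :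
    (α →ᵇ (E →L[ℝ] F)) →L[ℝ] (α →ᵇ E) →L[ℝ] (α →ᵇ F) :=
  LinearMap.mkContinuous₂
    (LinearMap.mk₂ ℝ
      (fun (a : α →ᵇ (E →L[ℝ] F)) (h : α →ᵇ E) =>
        BoundedContinuousFunction.ofNormedAddCommGroup (fun t => a t (h t))
        (a.continuous.clm_apply h.continuous) (‖a‖ * ‖h‖) fun t =>
          (a t).le_of_opNorm_le_of_le (a.norm_coe_le_norm t) (h.norm_coe_le_norm t))
      (fun _ _ _ => by ext; simp) (fun _ _ _ => by ext; simp)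
      (fun _ _ _ => by ext; simp) (fun _ _ _ => by ext; simp))
    1 fun a h => by
      rw [one_mul]
      exact (BoundedContinuousFunction.norm_le (by positivity)).2 fun t =>
        (a t).le_of_opNorm_le_of_le (a.norm_coe_le_norm t) (h.norm_coe_le_norm t)

@[simp]
theorem pointwiseApply_apply {α E F : Type*} [TopologicalSpace α]
    [NormedAddCommGroup E] [NormedSpace ℝ E] [NormedAddCommGroup F] [NormedSpace ℝ F]
    (a : α →ᵇ (E →L[ℝ] F)) (h : α →ᵇ E) (t : α) :
    pointwiseApply α E F a h t = a t (h t) := rfl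

theorem hasFDerivAt_nemytskii [NormedSpace ℝ E] [NormedSpace ℝ F] (g : C(E, F)) (g' : C(E, E →L[ℝ] F))
    (hg : ∀ x, HasFDerivAt g (g' x) x) (γ : α →ᵇ E) :
    HasFDerivAt (nemytskii g) (pointwiseApply α E F (nemytskii g' γ)) γ := by
  rw [hasFDerivAt_iff_isLittleO_nhds_zero, Asymptotics.isLittleO_iff]
  intro ε hε
  have hu := (isCompact_closedBall (0 : E) (‖γ‖ + 1)).uniformContinuousOn_of_continuous
    g'.continuous.continuousOn
  obtain ⟨δ, hδ, h⟩ := Metric.uniformContinuousOn_iff.1 hu ε hε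
  filter_upwards [Metric.ball_mem_nhds (0 : α →ᵇ E) (lt_min hδ one_pos)] with η hη
  rw [mem_ball_zero_iff] at hη
  rw [BoundedContinuousFunction.norm_le (by positivity)]
  intro t
  have h2 : ‖γ t‖ ≤ ‖γ‖ := γ.norm_coe_le_norm t
  have h3 : ‖η t‖ ≤ ‖η‖ := η.norm_coe_le_norm t
  have key := (convex_ball (γ t) (min δ 1)).norm_image_sub_le_of_norm_hasFDerivWithin_le'
    (f := g) (f' := g') (φ := g' (γ t)) (C := ε)
    (fun x _ => (hg x).hasFDerivWithinAt) (fun x hx => ?_) (x := γ t) (y := γ t + η t)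
    (Metric.mem_ball_self (lt_min hδ one_pos)) (by simpa using h3.trans_lt hη)
  · simp only [add_sub_cancel_left] at key
    refine (le_of_eq ?_).trans (key.trans (by gcongr))
    simp
  · rw [← dist_eq_norm]
    rw [Metric.mem_ball] at hx
    refine (h _ ?_ _ ?_ (hx.trans_le (min_le_left _ _))).le
    · rw [mem_closedBall_zero_iff]
      have := norm_le_norm_add_norm_sub' x (γ t)
      rw [← dist_eq_norm] at this
      linarith [hx.trans_le (min_le_right δ 1)]
    · rw [mem_closedBall_zero_iff]; linarith

end Nemytskii

section Smooth

universe u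
variable {α : Type*} [TopologicalSpace α]
  {E : Type u} [NormedAddCommGroup E] [NormedSpace ℝ E] [ProperSpace E]

/-- The superposition operator inherits the smoothness of `g`: its derivative is the pointwise
action of the superposition operator of `fderiv ℝ g`, which permits an induction. -/
theorem contDiff_nemytskii_nat (n : ℕ) {F : Type u} [NormedAddCommGroup F] [NormedSpace ℝ F]
    (g : C(E, F)) (hg : ContDiff ℝ n g) : ContDiff ℝ n (nemytskii g : (α →ᵇ E) → (α →ᵇ F)) := by
  induction n generalizing F with
  | zero => exact contDiff_zero.2 (continuous_nemytskii g)
  | succ n ih =>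
    rw [Nat.cast_succ] at hg ⊢
    have hg' := contDiff_succ_iff_fderiv.1 hg
    let g' : C(E, E →L[ℝ] F) := ⟨fderiv ℝ g, hg'.2.2.continuous⟩
    have hd := hasFDerivAt_nemytskii (α := α) g g' fun x => (hg'.1 x).hasFDerivAt
    refine contDiff_succ_iff_fderiv.2 ⟨fun γ => (hd γ).differentiableAt, by simp, ?_⟩
    rw [show fderiv ℝ (nemytskii g) = fun γ => pointwiseApply α E F (nemytskii g' γ) from
      funext fun γ => (hd γ).fderiv]
    exact (pointwiseApply α E F).contDiff.comp (ih g' hg'.2.2)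

theorem contDiff_nemytskii {F : Type u} [NormedAddCommGroup F] [NormedSpace ℝ F]
    (g : C(E, F)) (hg : ContDiff ℝ ∞ g) : ContDiff ℝ ∞ (nemytskii g : (α →ᵇ E) → (α →ᵇ F)) :=
  contDiff_infty.2 fun n => contDiff_nemytskii_nat n g (contDiff_infty.1 hg n)

end Smooth

/-! ### Smooth dependence of the fixed point of a contraction on an additive parameter -/

section Contraction

open scoped NNReal

variable {X : Type*} [NormedAddCommGroup X] [CompleteSpace X]

/-- If `T` is a smooth contraction, then the fixed point of `x ↦ y + T x` depends smoothly
on `y`. -/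
theorem exists_contDiff_fixedPoint [NormedSpace ℝ X] {T : X → X} {q : ℝ≥0} (hT : ContDiff ℝ ∞ T) (hq : q < 1)
    (hTq : LipschitzWith q T) :
    ∃ S : X → X, ContDiff ℝ ∞ S ∧ ∀ x y, S y = x ↔ x = y + T x := by
  have happ : ApproximatesLinearOn (fun x => x - T x)
      ((ContinuousLinearEquiv.refl ℝ X : X ≃L[ℝ] X) : X →L[ℝ] X) univ q := by
    intro x _ y _
    have := hTq.norm_sub_le x y
    rw [norm_sub_rev] at this
    rwa [show T y - T x = x - T x - (y - T y) - (x - y) by abel] at this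
  have hc : Subsingleton X ∨ q < ‖((ContinuousLinearEquiv.refl ℝ X : X ≃L[ℝ] X).symm :
      X →L[ℝ] X)‖₊⁻¹ := by
    rcases subsingleton_or_nontrivial X with h | h
    · exact .inl h
    · right
      have : ‖((ContinuousLinearEquiv.refl ℝ X : X ≃L[ℝ] X).symm : X →L[ℝ] X)‖₊ = 1 := by
        have := ContinuousLinearMap.norm_id (𝕜 := ℝ) (E := X)
        exact NNReal.eq this
      rw [this]; simpa using hq
  let H := happ.toHomeomorph _ hc
  have hH : ∀ x, H x = x - T x := fun x => rfl
  have hder : ∀ a, ∃ e : X ≃L[ℝ] X, HasFDerivAt H (e : X →L[ℝ] X) a := by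
    intro a
    have h1 : ‖fderiv ℝ T a‖ < 1 :=
      (norm_fderiv_le_of_lipschitz ℝ hTq).trans_lt (by exact_mod_cast hq)
    refine ⟨ContinuousLinearEquiv.unitsEquiv ℝ X (Units.oneSub (fderiv ℝ T a) h1), ?_⟩
    exact (hasFDerivAt_id a).sub ((hT.differentiable (by simp)) a).hasFDerivAt
  choose e he using hder
  refine ⟨H.symm, H.contDiff_symm (f₀' := e) he (contDiff_id.sub hT), fun x y => ?_⟩
  rw [H.symm_apply_eq, hH, eq_sub_iff_add_eq, eq_comm]

/-- The fixed point of a contraction lies in every nonempty closed invariant set. -/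
theorem mem_of_contraction_of_isClosed {T : X → X} {q : ℝ≥0} (hq : q < 1)
    (hTq : LipschitzWith q T) {x y : X} (hx : x = y + T x) {s : Set X} (hs : IsClosed s)
    (hne : s.Nonempty) (hmaps : ∀ z ∈ s, y + T z ∈ s) : x ∈ s := by
  have hc : ContractingWith q (fun z => y + T z) :=
    ⟨hq, LipschitzWith.of_dist_le_mul fun a b => by simpa using hTq.dist_le_mul a b⟩
  obtain ⟨z, hz⟩ := hne
  rw [hc.fixedPoint_unique (x := x) hx.symm]
  refine hs.mem_of_tendsto (hc.tendsto_iterate_fixedPoint z) (Eventually.of_forall fun n => ?_)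
  induction n with
  | zero => exact hz
  | succ n ih => rw [Function.iterate_succ_apply']; exact hmaps _ ih

end Contraction

/-! ### Bounded solutions of scalar linear equations on the half-line -/

section Duhamel

open MeasureTheory

variable {E : Type*} [NormedAddCommGroup E] [NormedSpace ℝ E]

/-- The solution of `k' = l • k + h` on `[0, ∞)` that is bounded whenever `h` is: for `l < 0` the one
which vanishes at `0`, for `l > 0` the one given by integration from infinity,
`k t = -∫ s in (t, ∞), exp (l * (t - s)) • h s`. -/
noncomputable def duhamelFun (l : ℝ) (h : ℝ → E) (t : ℝ) : E :=
  Real.exp (l * t) • ((∫ s in (0 : ℝ)..t, Real.exp (-l * s) • h s) -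
    if l < 0 then 0 else ∫ s in Ioi (0 : ℝ), Real.exp (-l * s) • h s)

theorem duhamelFun_zero_of_neg {l : ℝ} (hl : l < 0) (h : ℝ → E) : duhamelFun l h 0 = 0 := by
  simp [duhamelFun, hl]

theorem hasDerivAt_duhamelFun [CompleteSpace E] (l : ℝ) {h : ℝ → E} (hh : Continuous h) (t : ℝ) :
    HasDerivAt (duhamelFun l h) (l • duhamelFun l h t + h t) t := by
  have hc : Continuous fun s => Real.exp (-l * s) • h s := by fun_prop
  have h1 : HasDerivAt (fun t => Real.exp (l * t)) (Real.exp (l * t) * l) t := by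
    simpa using ((hasDerivAt_id t).const_mul l).exp
  have h2 := intervalIntegral.integral_hasDerivAt_right (hc.intervalIntegrable 0 t)
    (hc.stronglyMeasurableAtFilter _ _) hc.continuousAt
  have h3 := h1.fun_smul (h2.sub_const
    (if l < 0 then 0 else ∫ s in Ioi (0 : ℝ), Real.exp (-l * s) • h s))
  refine h3.congr_deriv ?_
  rw [smul_smul, ← Real.exp_add]
  simp only [duhamelFun, smul_smul, neg_mul, add_neg_cancel, Real.exp_zero, one_smul]
  rw [add_comm, mul_comm _ l]

theorem integrableOn_exp_smul_Ioi {l : ℝ} (hl : 0 < l) {h : ℝ → E} (hh : Continuous h) {A c : ℝ}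
    (hc : 0 ≤ c) (hA : ∀ s, 0 ≤ s → ‖h s‖ ≤ A * Real.exp (-c * s)) :
    IntegrableOn (fun s => Real.exp (-l * s) • h s) (Ioi 0) := by
  refine Integrable.mono' ((integrableOn_exp_mul_Ioi (a := -(l + c)) (by linarith) 0).const_mul A)
    (Continuous.aestronglyMeasurable (by fun_prop)) ?_
  filter_upwards [ae_restrict_mem measurableSet_Ioi] with s hs
  rw [norm_smul, Real.norm_eq_abs, Real.abs_exp, show -(l + c) * s = -l * s + -c * s by ring,
    Real.exp_add]
  nlinarith [hA s (le_of_lt hs), Real.exp_pos (-l * s)]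

theorem norm_duhamelFun_le {l : ℝ} {h : ℝ → E} (hh : Continuous h) {A c : ℝ}
    (hc : 0 ≤ c) (hcl : c < |l|) (hA : ∀ s, 0 ≤ s → ‖h s‖ ≤ A * Real.exp (-c * s)) {t : ℝ}
    (ht : 0 ≤ t) : ‖duhamelFun l h t‖ ≤ A / (|l| - c) * Real.exp (-c * t) := by
  have hA0 : 0 ≤ A := by simpa using (norm_nonneg _).trans (hA 0 le_rfl)
  have hpt : ∀ s, 0 ≤ s → ‖Real.exp (-l * s) • h s‖ ≤ A * Real.exp (-(l + c) * s) := by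
    intro s hs
    rw [norm_smul, Real.norm_eq_abs, Real.abs_exp, show -(l + c) * s = -l * s + -c * s by ring,
      Real.exp_add]
    nlinarith [hA s hs, Real.exp_pos (-l * s)]
  rw [duhamelFun, norm_smul, Real.norm_eq_abs, Real.abs_exp]
  rcases lt_or_ge l 0 with hl | hl
  · rw [abs_of_neg hl] at hcl ⊢
    have hint : ∫ s in (0 : ℝ)..t, A * Real.exp (-(l + c) * s) =
        A / (-l - c) * (Real.exp (-(l + c) * t) - 1) := by
      have hd : ∀ s ∈ uIcc 0 t, HasDerivAt (fun s => A / (-l - c) * Real.exp (-(l + c) * s))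
          (A * Real.exp (-(l + c) * s)) s := fun s _ => by
        have h1 : HasDerivAt (fun s => Real.exp (-(l + c) * s))
            (Real.exp (-(l + c) * s) * -(l + c)) s := by
          simpa using ((hasDerivAt_id s).const_mul (-(l + c))).exp
        refine (h1.const_mul (A / (-l - c))).congr_deriv ?_
        have : -l - c ≠ 0 := by linarith
        rw [show -(l + c) = -l - c by ring]
        field_simp
      rw [intervalIntegral.integral_eq_sub_of_hasDerivAt hd
        (Continuous.intervalIntegrable (by fun_prop) _ _)]
      simp [mul_sub]
    have h1 := intervalIntegral.norm_integral_le_of_norm_le ht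
      (f := fun s => Real.exp (-l * s) • h s) (g := fun s => A * Real.exp (-(l + c) * s))
      (μ := volume) (Eventually.of_forall fun s hs => hpt s hs.1.le)
      (Continuous.intervalIntegrable (by fun_prop) _ _)
    rw [hint] at h1
    rw [if_pos hl, sub_zero]
    have h2 : Real.exp (l * t) * Real.exp (-(l + c) * t) = Real.exp (-c * t) := by
      rw [← Real.exp_add]; ring_nf
    calc _ ≤ Real.exp (l * t) * (A / (-l - c) * (Real.exp (-(l + c) * t) - 1)) := by gcongr
      _ = A / (-l - c) * Real.exp (-c * t) - A / (-l - c) * Real.exp (l * t) := by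
        rw [← h2]; ring
      _ ≤ _ := by
        have : 0 ≤ A / (-l - c) := div_nonneg hA0 (by linarith)
        have := mul_nonneg this (Real.exp_pos (l * t)).le
        linarith
  · have hl0 : 0 < l := by
      rcases hl.eq_or_lt with rfl | h
      · simp at hcl; linarith
      · exact h
    rw [abs_of_pos hl0] at hcl ⊢
    have hi := integrableOn_exp_smul_Ioi hl0 hh hc hA
    rw [if_neg hl.not_gt, ← intervalIntegral.integral_interval_add_Ioi hi
      (hi.mono_set (Ioi_subset_Ioi ht)), sub_add_cancel_left, norm_neg]
    have h1 := norm_integral_le_of_norm_le (μ := volume.restrict (Ioi t))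
      (f := fun s => Real.exp (-l * s) • h s) (g := fun s => A * Real.exp (-(l + c) * s))
      ((integrableOn_exp_mul_Ioi (a := -(l + c)) (by linarith) t).const_mul A) (by
        filter_upwards [ae_restrict_mem measurableSet_Ioi] with s hs
        exact hpt s (ht.trans hs.le))
    rw [integral_const_mul, integral_exp_mul_Ioi (by linarith)] at h1
    have h2 : Real.exp (l * t) * Real.exp (-(l + c) * t) = Real.exp (-c * t) := by
      rw [← Real.exp_add]; ring_nf
    calc _ ≤ Real.exp (l * t) * (A * (-Real.exp (-(l + c) * t) / -(l + c))) := by gcongr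
      _ = A / (l + c) * Real.exp (-c * t) := by
        rw [← h2, neg_div_neg_eq]; ring
      _ ≤ _ := by
        gcongr; linarith

theorem norm_duhamelFun_max_le {l : ℝ} (hl : l ≠ 0) (h : ℝ →ᵇ E) (t : ℝ) :
    ‖duhamelFun l h (max t 0)‖ ≤ |l|⁻¹ * ‖h‖ := by
  have := norm_duhamelFun_le (l := l) (A := ‖h‖) h.continuous le_rfl (by simpa using hl)
    (fun s _ => by simpa using h.norm_coe_le_norm s) (le_max_right t 0)
  simpa [div_eq_inv_mul] using this

/-- The operator sending a bounded continuous `h` to `duhamelFun l h` on `[0, ∞)`, extended to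
negative times by its value at `0`. -/
noncomputable def duhamel (E : Type*) [NormedAddCommGroup E] [NormedSpace ℝ E] [CompleteSpace E]
    {l : ℝ} (hl : l ≠ 0) : (ℝ →ᵇ E) →L[ℝ] (ℝ →ᵇ E) :=
  have hb := fun h t => norm_duhamelFun_max_le hl h t
  have hint : ¬ l < 0 → ∀ h : ℝ →ᵇ E,
      IntegrableOn (fun s => Real.exp (-l * s) • h s) (Ioi 0) := fun h0 h =>
    integrableOn_exp_smul_Ioi (A := ‖h‖) (lt_of_le_of_ne (not_lt.1 h0) hl.symm) h.continuous le_rfl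
      fun s _ => by simpa using h.norm_coe_le_norm s
  have hint' : ∀ (h : ℝ →ᵇ E) (a b : ℝ),
      IntervalIntegrable (fun s => Real.exp (-l * s) • h s) volume a b := fun h a b =>
    Continuous.intervalIntegrable (by fun_prop) a b
  LinearMap.mkContinuous
    { toFun := fun h => .ofNormedAddCommGroup (fun t => duhamelFun l h (max t 0))
        ((continuous_iff_continuousAt.2 fun t =>
          (hasDerivAt_duhamelFun l h.continuous t).continuousAt).comp (by fun_prop)) _ (hb h)
      map_add' := fun h k => by
        ext t
        simp only [BoundedContinuousFunction.coe_ofNormedAddCommGroup,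
          BoundedContinuousFunction.coe_add, Pi.add_apply, duhamelFun, smul_add]
        rw [intervalIntegral.integral_add (hint' _ _ _) (hint' _ _ _)]
        split_ifs with h0
        · simp
        · rw [integral_add (hint h0 _) (hint h0 _), ← smul_add]
          congr 1
          abel
      map_smul' := fun a h => by
        ext t
        simp only [BoundedContinuousFunction.coe_ofNormedAddCommGroup, RingHom.id_apply,
          BoundedContinuousFunction.coe_smul, duhamelFun, smul_comm _ a]
        rw [intervalIntegral.integral_smul]
        split_ifs with h0
        · simp [smul_comm _ a]
        · rw [integral_smul, ← smul_sub, smul_comm] }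
    |l|⁻¹ fun h => (BoundedContinuousFunction.norm_le (by positivity)).2 (hb h)

theorem duhamel_apply [CompleteSpace E] {l : ℝ} (hl : l ≠ 0) (h : ℝ →ᵇ E) (t : ℝ) :
    duhamel E hl h t = duhamelFun l h (max t 0) := rfl

theorem norm_duhamel_le [CompleteSpace E] {l : ℝ} (hl : l ≠ 0) (h : ℝ →ᵇ E) : ‖duhamel E hl h‖ ≤ |l|⁻¹ * ‖h‖ :=
  (BoundedContinuousFunction.norm_le (by positivity)).2 (norm_duhamelFun_max_le hl h)

theorem hasDerivWithinAt_duhamel [CompleteSpace E] {l : ℝ} (hl : l ≠ 0) (h : ℝ →ᵇ E) {t : ℝ} (ht : 0 ≤ t) :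
    HasDerivWithinAt (duhamel E hl h) (l • duhamel E hl h t + h t) (Ici 0) t := by
  have := (hasDerivAt_duhamelFun l h.continuous t).hasDerivWithinAt (s := Ici 0)
  rw [duhamel_apply, max_eq_left ht]
  refine this.congr (fun s hs => ?_) ?_
  · rw [duhamel_apply, max_eq_left hs]
  · rw [duhamel_apply, max_eq_left ht]

theorem eq_exp_smul_of_hasDerivWithinAt {l : ℝ} {d : ℝ → E}
    (hd : ∀ t, 0 ≤ t → HasDerivWithinAt d (l • d t) (Ici 0) t) {t : ℝ} (ht : 0 ≤ t) :
    d t = Real.exp (l * t) • d 0 := by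
  have h1 : ∀ s, HasDerivAt (fun s => Real.exp (-l * s)) (Real.exp (-l * s) * -l) s := fun s => by
    simpa using ((hasDerivAt_id s).const_mul (-l)).exp
  have h2 : ∀ s, 0 ≤ s → HasDerivWithinAt (fun s => Real.exp (-l * s) • d s) 0 (Ici 0) s := by
    intro s hs
    refine ((h1 s).hasDerivWithinAt.fun_smul (hd s hs)).congr_deriv ?_
    rw [smul_smul, ← add_smul]
    simp
  have h3 := constant_of_has_deriv_right_zero (f := fun s => Real.exp (-l * s) • d s) (a := 0)
    (b := t) (fun s hs => ((h2 s hs.1).continuousWithinAt).mono Icc_subset_Ici_self)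
    (fun s hs => (h2 s hs.1).mono (Ici_subset_Ici.2 hs.1)) t ⟨ht, le_rfl⟩
  simp only [mul_zero, Real.exp_zero, one_smul] at h3
  rw [← h3, smul_smul, ← Real.exp_add]
  simp

/-- Variation of constants: a bounded solution of `y' = l • y + h` on `[0, ∞)` is determined by its
initial value if `l < 0`, and is unique if `l > 0`. -/
theorem eq_duhamel_of_bounded [CompleteSpace E] {l : ℝ} (hl : l ≠ 0) {y : ℝ → E} {h : ℝ →ᵇ E} {C : ℝ}
    (hb : ∀ t, 0 ≤ t → ‖y t‖ ≤ C)
    (hy : ∀ t, 0 ≤ t → HasDerivWithinAt y (l • y t + h t) (Ici 0) t) {t : ℝ} (ht : 0 ≤ t) :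
    y t = (if l < 0 then Real.exp (l * t) • y 0 else 0) + duhamel E hl h t := by
  set k := duhamel E hl h with hk
  have hd : ∀ t, 0 ≤ t → HasDerivWithinAt (fun t => y t - k t) (l • (y t - k t)) (Ici 0) t := by
    intro t ht
    refine ((hy t ht).fun_sub (hasDerivWithinAt_duhamel hl h ht)).congr_deriv ?_
    rw [smul_sub]; abel
  have h1 := fun t (ht : (0 : ℝ) ≤ t) => eq_exp_smul_of_hasDerivWithinAt hd ht
  split_ifs with h0
  · have h2 : k 0 = 0 := by
      rw [hk, duhamel_apply, max_self, duhamelFun_zero_of_neg h0]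
    have := h1 t ht
    simp only [h2, sub_zero] at this
    rw [← this]; abel
  · have hlp : 0 < l := lt_of_le_of_ne (not_lt.1 h0) hl.symm
    -- a nonzero multiple of the growing exponential is unbounded
    have hz : y 0 - k 0 = 0 := by
      by_contra hne
      have hpos : 0 < ‖y 0 - k 0‖ := norm_pos_iff.2 hne
      have hlim : Tendsto (fun t => Real.exp (l * t) * ‖y 0 - k 0‖) atTop atTop :=
        (Real.tendsto_exp_atTop.comp (tendsto_id.const_mul_atTop hlp)).atTop_mul_const hpos
      obtain ⟨t, ht, ht0⟩ := ((hlim.eventually_gt_atTop (C + ‖k‖)).and (eventually_ge_atTop 0)).exists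
      have h3 : ‖y t - k t‖ = Real.exp (l * t) * ‖y 0 - k 0‖ := by
        rw [h1 t ht0, norm_smul, Real.norm_eq_abs, Real.abs_exp]
      have h4 := norm_sub_le (y t) (k t)
      have h5 := k.norm_coe_le_norm t
      linarith [hb t ht0]
    have := h1 t ht
    rw [hz, smul_zero, sub_eq_zero] at this
    rw [this, zero_add]

/-- The decaying exponential `t ↦ exp (l * max t 0)` for `l ≤ 0`. -/
noncomputable def expDecay {l : ℝ} (hl : l ≤ 0) : ℝ →ᵇ ℝ :=
  .ofNormedAddCommGroup (fun t => Real.exp (l * max t 0)) (by fun_prop) 1 fun t => by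
    rw [Real.norm_eq_abs, Real.abs_exp]
    exact Real.exp_le_one_iff.2 (mul_nonpos_of_nonpos_of_nonneg hl (le_max_right _ _))

/-- The linear operator `x ↦ (t ↦ exp (l * max t 0) • x)`, for `l ≤ 0`. -/
noncomputable def expDecaySMul (E : Type*) [NormedAddCommGroup E] [NormedSpace ℝ E] {l : ℝ}
    (hl : l ≤ 0) : E →L[ℝ] (ℝ →ᵇ E) :=
  LinearMap.mkContinuous
    { toFun := fun x => .ofNormedAddCommGroup (fun t => expDecay hl t • x) (by fun_prop)
        (‖expDecay hl‖ * ‖x‖) fun t => by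
          rw [norm_smul]; gcongr; exact (expDecay hl).norm_coe_le_norm t
      map_add' := fun _ _ => by ext; simp
      map_smul' := fun a x => by ext t; simp [smul_comm _ a] }
    ‖expDecay hl‖ fun x => (BoundedContinuousFunction.norm_le (by positivity)).2 fun t =>
      (norm_smul_le _ _).trans (by gcongr; exact (expDecay hl).norm_coe_le_norm t)

theorem expDecaySMul_apply {l : ℝ} (hl : l ≤ 0) (x : E) (t : ℝ) :
    expDecaySMul E hl x t = Real.exp (l * max t 0) • x := rfl

end Duhamel

/-! ### Smooth dependence of solutions on the initial value -/

section Flow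

open scoped NNReal

universe u

variable {E : Type u} [NormedAddCommGroup E] [NormedSpace ℝ E]

theorem hasDerivWithinAt_expDecaySMul {l : ℝ} (hl : l ≤ 0) (x : E) {t : ℝ} (ht : 0 ≤ t) :
    HasDerivWithinAt (expDecaySMul E hl x) (l • expDecaySMul E hl x t) (Ici 0) t := by
  have h1 : HasDerivAt (fun t => Real.exp (l * t) • x) ((Real.exp (l * t) * l) • x) t := by
    simpa using (((hasDerivAt_id t).const_mul l).exp).smul_const x
  rw [expDecaySMul_apply, max_eq_left ht, smul_smul, mul_comm]
  refine h1.hasDerivWithinAt.congr (fun s hs => ?_) ?_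
  · rw [expDecaySMul_apply, max_eq_left hs]
  · rw [expDecaySMul_apply, max_eq_left ht]

/-- A Lipschitz `C^∞` vector field has solutions on `[0, T]` depending smoothly on their initial
values. In the unknown `exp (-w * t) • γ t` with `w` larger than the Lipschitz constant, the integral
equation is a contraction on the bounded continuous functions; its explicit time dependence enters
the superposition operator as a second, frozen argument. -/
theorem exists_contDiff_solution [FiniteDimensional ℝ E] {f : E → E} {L : ℝ≥0}
    (hf : ContDiff ℝ ∞ f) (hL : LipschitzWith L f) (T : ℝ) (hT : 0 ≤ T) :
    ∃ φ : E → ℝ → E, (∀ x, φ x 0 = x) ∧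
      (∀ x, ∀ t ∈ Icc 0 T, HasDerivWithinAt (φ x) (f (φ x t)) (Icc 0 T) t) ∧
      ∀ t, ContDiff ℝ ∞ fun x => φ x t := by
  have : ProperSpace E := FiniteDimensional.proper ℝ E
  have : CompleteSpace E := FiniteDimensional.complete ℝ E
  let w : ℝ := L + 1
  have hw : 0 < w := by positivity
  have hwl : -w < 0 := by linarith
  let g : C(E × ℝ, E) := ⟨fun p => Real.exp (-w * p.2) • f (Real.exp (w * p.2) • p.1), by
    have := hf.continuous; fun_prop⟩
  have hg : ContDiff ℝ ∞ g := by
    change ContDiff ℝ ∞ fun p : E × ℝ => Real.exp (-w * p.2) • f (Real.exp (w * p.2) • p.1)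
    fun_prop
  let τ : ℝ →ᵇ ℝ := .ofNormedAddCommGroup (fun t => max 0 (min t T)) (by fun_prop) T fun t => by
    rw [Real.norm_eq_abs, abs_of_nonneg (le_max_left _ _)]
    exact max_le hT (min_le_right _ _)
  have hτ : ∀ t ∈ Icc 0 T, τ t = t := fun t ht => by
    change max 0 (min t T) = t
    rw [min_eq_left ht.2, max_eq_right ht.1]
  let P : (ℝ →ᵇ E) → (ℝ →ᵇ E × ℝ) := fun y =>
    (ContinuousLinearMap.inl ℝ E ℝ).compLeftContinuousBounded ℝ y +
      (ContinuousLinearMap.inr ℝ E ℝ).compLeftContinuousBounded ℝ τ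
  have hPapply : ∀ y t, P y t = (y t, τ t) := fun y t => by simp [P]
  have hP : ContDiff ℝ ∞ P := (ContinuousLinearMap.contDiff _).add contDiff_const
  let N : (ℝ →ᵇ E) → (ℝ →ᵇ E) := fun y => duhamel E hwl.ne (nemytskii g (P y))
  have hN : ContDiff ℝ ∞ N :=
    (duhamel E hwl.ne).contDiff.comp ((contDiff_nemytskii g hg).comp hP)
  have hNq : LipschitzWith (L / (L + 1)) N := by
    refine LipschitzWith.of_dist_le_mul fun y z => ?_
    rw [dist_eq_norm, dist_eq_norm, ← map_sub]
    refine (norm_duhamel_le _ _).trans ?_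
    have h1 : ‖nemytskii g (P y) - nemytskii g (P z)‖ ≤ L * ‖y - z‖ := by
      rw [BoundedContinuousFunction.norm_le (by positivity)]
      intro t
      change ‖g (P y t) - g (P z t)‖ ≤ _
      rw [hPapply, hPapply]
      change ‖Real.exp (-w * τ t) • f (Real.exp (w * τ t) • y t) -
        Real.exp (-w * τ t) • f (Real.exp (w * τ t) • z t)‖ ≤ _
      rw [← smul_sub, norm_smul, Real.norm_eq_abs, Real.abs_exp]
      have h2 := hL.norm_sub_le (Real.exp (w * τ t) • y t) (Real.exp (w * τ t) • z t)
      rw [← smul_sub, norm_smul, Real.norm_eq_abs, Real.abs_exp] at h2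
      have h3 : Real.exp (-w * τ t) * Real.exp (w * τ t) = 1 := by rw [← Real.exp_add]; simp
      calc _ ≤ Real.exp (-w * τ t) * (L * (Real.exp (w * τ t) * ‖y t - z t‖)) := by gcongr
        _ = L * ‖y t - z t‖ := by linear_combination (L * ‖y t - z t‖) * h3
        _ ≤ _ := by gcongr; exact (y - z).norm_coe_le_norm t
    rw [abs_neg, abs_of_pos hw]
    calc _ ≤ w⁻¹ * (L * ‖y - z‖) := by gcongr
      _ = _ := by rw [NNReal.coe_div]; push_cast; ring
  obtain ⟨S, hS, hSeq⟩ := exists_contDiff_fixedPoint hN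
    (by rw [div_lt_one (by positivity)]; exact lt_add_one L) hNq
  let Y : E → (ℝ →ᵇ E) := fun x => S (expDecaySMul E hwl.le x)
  have hY : ContDiff ℝ ∞ Y := hS.comp (expDecaySMul E hwl.le).contDiff
  have hYeq : ∀ x, Y x = expDecaySMul E hwl.le x + N (Y x) := fun x => (hSeq _ _).1 rfl
  have hYeq' : ∀ x t, Y x t = expDecaySMul E hwl.le x t + N (Y x) t := fun x t =>
    congrArg (fun y : ℝ →ᵇ E => y t) (hYeq x)
  refine ⟨fun x t => Real.exp (w * t) • Y x t, fun x => ?_, fun x t ht => ?_, fun t => ?_⟩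
  · simp [hYeq' x 0, expDecaySMul_apply, N, duhamel_apply, duhamelFun_zero_of_neg hwl]
  · have h1 : HasDerivAt (fun t => Real.exp (w * t)) (Real.exp (w * t) * w) t := by
      simpa using ((hasDerivAt_id t).const_mul w).exp
    have h2 : HasDerivWithinAt (Y x) (-w • Y x t + g (Y x t, t)) (Ici 0) t := by
      have h3 := (hasDerivWithinAt_expDecaySMul hwl.le x ht.1).fun_add
        (hasDerivWithinAt_duhamel hwl.ne (nemytskii g (P (Y x))) ht.1)
      refine (h3.congr_deriv ?_).congr (fun s _ => hYeq' x s) (hYeq' x t)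
      rw [nemytskii_apply, hPapply, hτ t ht, ← add_assoc, ← smul_add]
      rw [← show Y x t = _ from hYeq' x t]
    refine ((h1.hasDerivWithinAt.fun_smul (h2.mono Icc_subset_Ici_self))).congr_deriv ?_
    change Real.exp (w * t) • (-w • Y x t + Real.exp (-w * t) • f (Real.exp (w * t) • Y x t)) + _ = _
    rw [smul_add, smul_smul, smul_smul, ← Real.exp_add]
    simp only [neg_mul, add_neg_cancel, Real.exp_zero, one_smul, mul_neg, neg_smul]
    abel
  · exact contDiff_const.smul
      ((BoundedContinuousFunction.evalCLM ℝ t : (ℝ →ᵇ E) →L[ℝ] E).contDiff.comp hY)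

theorem dist_le_of_lipschitz_of_solution {f : E → E} {L : ℝ≥0} (hL : LipschitzWith L f) {T : ℝ}
    {γ η : ℝ → E} (hγ : ∀ t ∈ Icc 0 T, HasDerivWithinAt γ (f (γ t)) (Icc 0 T) t)
    (hη : ∀ t ∈ Icc 0 T, HasDerivWithinAt η (f (η t)) (Icc 0 T) t) {t : ℝ} (ht : t ∈ Icc 0 T) :
    dist (γ t) (η t) ≤ dist (γ 0) (η 0) * Real.exp (L * T) := by
  have h := dist_le_of_trajectories_ODE (v := fun _ => f) (fun _ => hL)
    (fun t ht => (hγ t ht).continuousWithinAt)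
    (fun t ht => (hγ t (Ico_subset_Icc_self ht)).mono_of_mem_nhdsWithin (Icc_mem_nhdsGE_of_mem ht))
    (fun t ht => (hη t ht).continuousWithinAt)
    (fun t ht => (hη t (Ico_subset_Icc_self ht)).mono_of_mem_nhdsWithin (Icc_mem_nhdsGE_of_mem ht))
    le_rfl t ht
  refine h.trans ?_
  gcongr
  linarith [ht.2]

/-- A `C^∞` function on an open set agrees near a compact subset with a Lipschitz `C^∞` function
on the whole space. -/
theorem exists_lipschitz_contDiff_eqOn [FiniteDimensional ℝ E] {F : Type*} [NormedAddCommGroup F]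
    [NormedSpace ℝ F] {f : E → F} {V K : Set E} (hV : IsOpen V) (hf : ContDiffOn ℝ ∞ f V)
    (hK : IsCompact K) (hKV : K ⊆ V) :
    ∃ (f' : E → F) (L : ℝ≥0) (W : Set E), ContDiff ℝ ∞ f' ∧ LipschitzWith L f' ∧ IsOpen W ∧
      K ⊆ W ∧ W ⊆ V ∧ EqOn f' f W := by
  have : ProperSpace E := FiniteDimensional.proper ℝ E
  obtain ⟨K', hK', hKK', hK'V⟩ := exists_compact_between hK hV hKV
  obtain ⟨χ, h1, h0, -⟩ := exists_contMDiffMap_one_nhds_of_subset_interior (n := ⊤)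
    (modelWithCornersSelf ℝ E) hK.isClosed hKK'
  have hχ : ContDiff ℝ ∞ χ := χ.contMDiff.contDiff
  obtain ⟨W₀, hW₀, hKW₀, hW₀1⟩ := mem_nhdsSet_iff_exists.1 h1
  have hsm : ContDiff ℝ ∞ fun x => χ x • f x := by
    rw [contDiff_iff_contDiffAt]
    intro x
    by_cases hx : x ∈ V
    · exact hχ.contDiffAt.smul (hf.contDiffAt (hV.mem_nhds hx))
    · have : (fun x => χ x • f x) =ᶠ[𝓝 x] fun _ => 0 := by
        filter_upwards [hK'.isClosed.isOpen_compl.mem_nhds fun h => hx (hK'V h)] with y hy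
        rw [h0 y hy, zero_smul]
      exact contDiffAt_const.congr_of_eventuallyEq this
  have hcs : HasCompactSupport fun x => χ x • f x :=
    HasCompactSupport.intro hK' fun x hx => by rw [h0 x hx, zero_smul]
  obtain ⟨L, hL⟩ := ContDiff.lipschitzWith_of_hasCompactSupport hcs hsm (by simp)
  refine ⟨_, L, W₀ ∩ V, hsm, hL, hW₀.inter hV, subset_inter hKW₀ hKV, inter_subset_right,
    fun x hx => ?_⟩
  have : χ x = 1 := hW₀1 hx.1
  simp [this]

/-- Two solutions with the same initial value agree, for a `C^∞` field on an open set. -/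
theorem eqOn_of_solution [FiniteDimensional ℝ E] {f : E → E} {V : Set E} (hV : IsOpen V)
    (hf : ContDiffOn ℝ ∞ f V) {T : ℝ} {γ η : ℝ → E}
    (hγ : ∀ t ∈ Icc 0 T, γ t ∈ V ∧ HasDerivWithinAt γ (f (γ t)) (Icc 0 T) t)
    (hη : ∀ t ∈ Icc 0 T, η t ∈ V ∧ HasDerivWithinAt η (f (η t)) (Icc 0 T) t) (h0 : γ 0 = η 0) :
    EqOn γ η (Icc 0 T) := by
  have hK : ∀ {ξ : ℝ → E}, (∀ t ∈ Icc 0 T, ξ t ∈ V ∧ HasDerivWithinAt ξ (f (ξ t)) (Icc 0 T) t) →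
      IsCompact (ξ '' Icc 0 T) := fun h => isCompact_Icc.image_of_continuousOn fun t ht =>
    (h t ht).2.continuousWithinAt
  obtain ⟨f', L, W, -, hL, -, hKW, -, hEq⟩ := exists_lipschitz_contDiff_eqOn hV hf
    ((hK hγ).union (hK hη))
    (union_subset (image_subset_iff.2 fun t ht => (hγ t ht).1)
      (image_subset_iff.2 fun t ht => (hη t ht).1))
  intro t ht
  have := dist_le_of_lipschitz_of_solution hL
    (γ := γ) (η := η)
    (fun t ht => by rw [hEq (hKW (.inl (mem_image_of_mem _ ht)))]; exact (hγ t ht).2)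
    (fun t ht => by rw [hEq (hKW (.inr (mem_image_of_mem _ ht)))]; exact (hη t ht).2) ht
  rwa [h0, dist_self, zero_mul, dist_le_zero] at this

theorem hasDerivWithinAt_comp_const_sub {T : ℝ} {γ : ℝ → E} {f : E → E}
    (hγ : ∀ t ∈ Icc 0 T, HasDerivWithinAt γ (f (γ t)) (Icc 0 T) t) {t : ℝ} (ht : t ∈ Icc 0 T) :
    HasDerivWithinAt (fun t => γ (T - t)) (-f (γ (T - t))) (Icc 0 T) t := by
  have hm : MapsTo (fun t => T - t) (Icc 0 T) (Icc 0 T) := fun s hs =>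
    ⟨by linarith [hs.2], by linarith [hs.1]⟩
  have h := (hγ (T - t) (hm ht)).scomp t ((hasDerivAt_id t).const_sub T).hasDerivWithinAt hm
  simpa [Function.comp_def] using h

/-- The time-`T` map of a Lipschitz `C^∞` field is a diffeomorphism. -/
theorem exists_homeomorph_solution [FiniteDimensional ℝ E] {f : E → E} {L : ℝ≥0}
    (hf : ContDiff ℝ ∞ f) (hL : LipschitzWith L f) (T : ℝ) (hT : 0 ≤ T) :
    ∃ (φ : E → ℝ → E) (Φ : E ≃ₜ E), ContDiff ℝ ∞ Φ ∧ ContDiff ℝ ∞ Φ.symm ∧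
      (∀ x, φ x 0 = x ∧ φ x T = Φ x) ∧
      ∀ x, ∀ t ∈ Icc 0 T, HasDerivWithinAt (φ x) (f (φ x t)) (Icc 0 T) t := by
  obtain ⟨φ, h0, hd, hs⟩ := exists_contDiff_solution hf hL T hT
  have hL' : LipschitzWith L fun x => -f x := hL.neg
  obtain ⟨ψ, h0', hd', hs'⟩ := exists_contDiff_solution (f := fun x => -f x) hf.neg hL' T hT
  have hTm : T ∈ Icc 0 T := ⟨hT, le_rfl⟩
  have hinv : ∀ x, ψ (φ x T) T = x := fun x => by
    have := dist_le_of_lipschitz_of_solution hL' (hd' (φ x T))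
      (fun t ht => hasDerivWithinAt_comp_const_sub (hd x) ht) hTm
    simpa [h0, h0'] using this
  have hinv' : ∀ x, φ (ψ x T) T = x := fun x => by
    have := dist_le_of_lipschitz_of_solution hL (hd (ψ x T))
      (fun t ht => by simpa using hasDerivWithinAt_comp_const_sub (f := fun x => -f x) (hd' x) ht)
      hTm
    simpa [h0, h0'] using this
  exact ⟨φ, ⟨⟨fun x => φ x T, fun x => ψ x T, hinv, hinv'⟩, (hs T).continuous, (hs' T).continuous⟩,
    hs T, hs' T, fun x => ⟨h0 x, rfl⟩, hd⟩

/-- The solutions starting near the initial point of a given solution on `[0, T]` exist on `[0, T]`,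
remain close to it, and their values at time `T` are given by a diffeomorphism. -/
theorem exists_flowBox [FiniteDimensional ℝ E] {f : E → E} {V : Set E} (hV : IsOpen V)
    (hf : ContDiffOn ℝ ∞ f V) {T : ℝ} (hT : 0 ≤ T) {γ : ℝ → E}
    (hγ : ∀ t ∈ Icc 0 T, γ t ∈ V ∧ HasDerivWithinAt γ (f (γ t)) (Icc 0 T) t)
    {ε : ℝ} (hε : 0 < ε) :
    ∃ (O : Set E) (φ : E → ℝ → E) (Φ : E ≃ₜ E), IsOpen O ∧ γ 0 ∈ O ∧ ContDiff ℝ ∞ Φ ∧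
      ContDiff ℝ ∞ Φ.symm ∧ (∀ x, φ x 0 = x ∧ φ x T = Φ x) ∧ ∀ x ∈ O, ∀ t ∈ Icc 0 T,
        dist (φ x t) (γ t) < ε ∧ φ x t ∈ V ∧
          HasDerivWithinAt (φ x) (f (φ x t)) (Icc 0 T) t := by
  have hK : IsCompact (γ '' Icc 0 T) := isCompact_Icc.image_of_continuousOn fun t ht =>
    (hγ t ht).2.continuousWithinAt
  obtain ⟨f', L, W, hf', hL, hW, hKW, hWV, hEq⟩ := exists_lipschitz_contDiff_eqOn hV hf
    hK (image_subset_iff.2 fun t ht => (hγ t ht).1)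
  obtain ⟨δ, hδ, hδW⟩ := hK.exists_thickening_subset_open hW hKW
  obtain ⟨φ, Φ, h1, h2, h3, h4⟩ := exists_homeomorph_solution hf' hL T hT
  refine ⟨Metric.ball (γ 0) (min ε δ / Real.exp (L * T)), φ, Φ, Metric.isOpen_ball,
    Metric.mem_ball_self (by positivity), h1, h2, h3, fun x hx t ht => ?_⟩
  have hd : dist (φ x t) (γ t) < min ε δ := by
    have := dist_le_of_lipschitz_of_solution hL (h4 x) (η := γ)
      (fun t ht => by rw [hEq (hKW (mem_image_of_mem _ ht))]; exact (hγ t ht).2) ht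
    rw [(h3 x).1] at this
    refine this.trans_lt ?_
    rwa [Metric.mem_ball, lt_div_iff₀ (Real.exp_pos _)] at hx
  have hmW : φ x t ∈ W := hδW (Metric.mem_thickening_iff.2
    ⟨γ t, mem_image_of_mem _ ht, hd.trans_le (min_le_right _ _)⟩)
  refine ⟨hd.trans_le (min_le_left _ _), hWV hmW, ?_⟩
  rw [← hEq hmW]
  exact h4 x t ht

end Flow

/-! ### Bounded solutions near a hyperbolic equilibrium -/

section Perron

open scoped NNReal

variable {ι : Type} [Fintype ι]

open Classical in
/-- The operator acting on the `i`-th coordinate as `duhamel ℝ (hl i)`: a bounded right inverse of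
`y ↦ y' - l * y` on `[0, ∞)`. -/
noncomputable def perronOperator {l : ι → ℝ} (hl : ∀ i, l i ≠ 0) :
    (ℝ →ᵇ (ι → ℝ)) →L[ℝ] (ℝ →ᵇ (ι → ℝ)) :=
  ∑ i, ((ContinuousLinearMap.single ℝ (fun _ : ι => ℝ) i).compLeftContinuousBounded ℝ).comp
    ((duhamel ℝ (hl i)).comp
      ((ContinuousLinearMap.proj (R := ℝ) (φ := fun _ : ι => ℝ) i).compLeftContinuousBounded ℝ))

theorem perronOperator_apply {l : ι → ℝ} (hl : ∀ i, l i ≠ 0) (h : ℝ →ᵇ (ι → ℝ)) (t : ℝ) (i : ι) :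
    perronOperator hl h t i = duhamel ℝ (hl i)
      ((ContinuousLinearMap.proj (R := ℝ) (φ := fun _ : ι => ℝ) i).compLeftContinuousBounded ℝ h)
      t := by
  rw [perronOperator, sum_apply, BoundedContinuousFunction.coe_sum,
    Finset.sum_apply, Finset.sum_apply, Finset.sum_eq_single i]
  · simp
  · intro j _ hj
    simp [hj.symm]
  · simp

theorem norm_perronOperator_le {l : ι → ℝ} (hl : ∀ i, l i ≠ 0) {μ : ℝ} (hμ : 0 < μ)
    (hμl : ∀ i, μ ≤ |l i|) (h : ℝ →ᵇ (ι → ℝ)) : ‖perronOperator hl h‖ ≤ μ⁻¹ * ‖h‖ := by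
  rw [BoundedContinuousFunction.norm_le (by positivity)]
  refine fun t => (pi_norm_le_iff_of_nonneg (by positivity)).2 fun i => ?_
  rw [perronOperator_apply]
  refine (BoundedContinuousFunction.norm_coe_le_norm _ t).trans ((norm_duhamel_le _ _).trans ?_)
  have h1 : ‖(ContinuousLinearMap.proj (R := ℝ) (φ := fun _ : ι => ℝ) i).compLeftContinuousBounded
      ℝ h‖ ≤ ‖h‖ := (BoundedContinuousFunction.norm_le (norm_nonneg _)).2 fun s =>
    (norm_le_pi_norm (h s) i).trans (h.norm_coe_le_norm s)
  gcongr
  exact hμl i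

open Classical in
/-- The bounded solutions on `[0, ∞)` of the linear system `y' = l * y`: the coordinates with
`l i < 0` decay from their initial values, the others vanish. -/
noncomputable def stableExp (l : ι → ℝ) : (ι → ℝ) →L[ℝ] (ℝ →ᵇ (ι → ℝ)) :=
  ∑ i, if h : l i < 0 then
    ((ContinuousLinearMap.single ℝ (fun _ : ι => ℝ) i).compLeftContinuousBounded ℝ).comp
      ((expDecaySMul ℝ h.le).comp (ContinuousLinearMap.proj (R := ℝ) (φ := fun _ : ι => ℝ) i))
    else 0

theorem stableExp_apply (l : ι → ℝ) (x : ι → ℝ) (t : ℝ) (i : ι) :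
    stableExp l x t i = if l i < 0 then Real.exp (l i * max t 0) * x i else 0 := by
  classical
  rw [stableExp, sum_apply, BoundedContinuousFunction.coe_sum,
    Finset.sum_apply, Finset.sum_apply, Finset.sum_eq_single i]
  · split_ifs with h
    · simp [expDecaySMul_apply]
    · simp
  · intro j _ hj
    split_ifs with h
    · simp [hj.symm]
    · simp
  · simp

/-- For the system `z' = l * z + g z` with hyperbolic diagonal linear part and a perturbation `g`
whose Lipschitz constant is smaller than the spectral gap, the bounded solutions on `[0, ∞)` are
parametrised smoothly by the coordinates of their initial values in the directions with `l i < 0`;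
all of them converge to the equilibrium. They are the fixed points of a contraction. -/
theorem exists_bounded_solutions {l : ι → ℝ} {μ : ℝ} (hμl : ∀ i, μ ≤ |l i|)
    {g : (ι → ℝ) → (ι → ℝ)} (hg : ContDiff ℝ ∞ g) (hg0 : g 0 = 0) {q : ℝ≥0}
    (hq : LipschitzWith q g) (hqμ : q < μ) :
    ∃ Γ : (ι → ℝ) → (ℝ →ᵇ (ι → ℝ)), ContDiff ℝ ∞ Γ ∧ Γ 0 = 0 ∧
      (∀ x y, (∀ i, l i < 0 → x i = y i) → Γ x = Γ y) ∧
      (∀ x i, l i < 0 → Γ x 0 i = x i) ∧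
      (∀ x, ∀ t ≤ 0, Γ x t = Γ x 0) ∧
      (∀ x, ∀ t, 0 ≤ t → HasDerivWithinAt (Γ x) (l * Γ x t + g (Γ x t)) (Ici 0) t) ∧
      (∀ x, Tendsto (Γ x) atTop (𝓝 0)) ∧
      (∀ (y : ℝ → ι → ℝ) (C : ℝ), (∀ t, 0 ≤ t → ‖y t‖ ≤ C) →
        (∀ t, 0 ≤ t → HasDerivWithinAt y (l * y t + g (y t)) (Ici 0) t) →
        ∀ t, 0 ≤ t → y t = Γ (y 0) t) ∧
      (∀ i, 0 < l i → fderiv ℝ (fun x => g x i) 0 = 0 →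
        HasFDerivAt (fun x => Γ x 0 i) (0 : (ι → ℝ) →L[ℝ] ℝ) 0) := by
  have hμ : 0 < μ := q.coe_nonneg.trans_lt hqμ
  have hl : ∀ i, l i ≠ 0 := fun i h => by
    have := hμl i
    rw [h, abs_zero] at this
    linarith
  let gc : C(ι → ℝ, ι → ℝ) := ⟨g, hg.continuous⟩
  let K := perronOperator hl
  let N : (ℝ →ᵇ (ι → ℝ)) → (ℝ →ᵇ (ι → ℝ)) := fun γ => K (nemytskii gc γ)
  have hN : ContDiff ℝ ∞ N := K.contDiff.comp (contDiff_nemytskii gc hg)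
  have hNq : LipschitzWith (q / μ.toNNReal) N := by
    refine LipschitzWith.of_dist_le_mul fun y z => ?_
    rw [dist_eq_norm, dist_eq_norm, ← map_sub]
    refine (norm_perronOperator_le hl hμ hμl _).trans ?_
    rw [NNReal.coe_div, Real.coe_toNNReal _ hμ.le, div_mul_eq_mul_div, div_eq_inv_mul]
    gcongr
    exact norm_nemytskii_sub_le gc hq y z
  have hq1 : q / μ.toNNReal < 1 := by
    rw [div_lt_one (by simpa using hμ)]
    exact Real.lt_toNNReal_iff_coe_lt.2 hqμ
  obtain ⟨S, hS, hSeq⟩ := exists_contDiff_fixedPoint hN hq1 hNq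
  let Γ : (ι → ℝ) → (ℝ →ᵇ (ι → ℝ)) := fun x => S (stableExp l x)
  have hΓ : ContDiff ℝ ∞ Γ := hS.comp (stableExp l).contDiff
  have hΓeq : ∀ x, Γ x = stableExp l x + N (Γ x) := fun x => (hSeq _ _).1 rfl
  have hNapply : ∀ γ t i, N γ t i = duhamelFun (l i) (fun s => g (γ s) i) (max t 0) :=
    fun γ t i => perronOperator_apply hl _ t i
  have hΓapply : ∀ x t i, Γ x t i = (if l i < 0 then Real.exp (l i * max t 0) * x i else 0) +
      duhamelFun (l i) (fun s => g (Γ x s) i) (max t 0) := fun x t i => by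
    rw [← hNapply, ← stableExp_apply]
    exact congrArg (fun y : ℝ →ᵇ (ι → ℝ) => y t i) (hΓeq x)
  have hN0 : N 0 = 0 := by
    have : nemytskii gc (0 : ℝ →ᵇ (ι → ℝ)) = 0 := by
      ext t : 1
      exact hg0
    change K _ = 0
    rw [this, map_zero]
  have hΓ0 : Γ 0 = 0 := (hSeq _ _).2 (by rw [map_zero, zero_add, hN0])
  refine ⟨Γ, hΓ, hΓ0, fun x y hxy => ?_, fun x i hi => ?_, fun x t ht => ?_, fun x t ht => ?_,
    fun x => ?_, fun y C hC hy t ht => ?_, fun i hi hgi => ?_⟩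
  · have : stableExp l x = stableExp l y := by
      ext t i
      rw [stableExp_apply, stableExp_apply]
      split_ifs with h
      · rw [hxy i h]
      · rfl
    simp only [Γ, this]
  · rw [hΓapply, if_pos hi, max_self, duhamelFun_zero_of_neg hi]
    simp
  · ext i
    rw [hΓapply, hΓapply, max_eq_right ht, max_self]
  · rw [hasDerivWithinAt_pi]
    intro i
    have hcont : Continuous fun s => g (Γ x s) i :=
      (continuous_apply i).comp (hg.continuous.comp (Γ x).continuous)
    have h1 : HasDerivAt (fun t => if l i < 0 then Real.exp (l i * t) * x i else 0)
        (l i * if l i < 0 then Real.exp (l i * t) * x i else 0) t := by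
      split_ifs with h
      · refine ((((hasDerivAt_id t).const_mul (l i)).exp).mul_const (x i)).congr_deriv ?_
        simp only [id, mul_one]; ring
      · simpa using hasDerivAt_const t (0 : ℝ)
    have h2 := (h1.fun_add (hasDerivAt_duhamelFun (l i) hcont t)).hasDerivWithinAt (s := Ici 0)
    refine (h2.congr_deriv ?_).congr (fun s hs => ?_) ?_
    · rw [Pi.add_apply, Pi.mul_apply, hΓapply, max_eq_left ht, smul_eq_mul]
      ring
    · rw [hΓapply, max_eq_left hs]
    · rw [hΓapply, max_eq_left ht]
  · -- the contraction preserves an exponential decay at any rate below the gap `μ - q`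
    let c : ℝ := (μ - q) / 2
    let A : ℝ := ‖x‖ * ((μ + q) / (μ - q))
    have hc : 0 < c := by simp only [c]; linarith
    have hcμ : c < μ := by simp only [c]; linarith [q.coe_nonneg]
    have hA : 0 ≤ A := by
      have : 0 < μ - q := by linarith
      positivity
    have hAeq : ‖x‖ + q * A / (μ - c) = A := by
      have h1 : μ - q ≠ 0 := by linarith
      have h2 : μ + q ≠ 0 := by positivity
      simp only [A, c]
      rw [show μ - (μ - q) / 2 = (μ + q) / 2 by ring]
      field_simp
      ring
    let s : Set (ℝ →ᵇ (ι → ℝ)) := {γ | ∀ t, 0 ≤ t → ‖γ t‖ ≤ A * Real.exp (-c * t)}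
    have hs : IsClosed s := by
      simp only [s, ofPred_forall]
      exact isClosed_iInter fun t => isClosed_iInter fun _ => isClosed_le
        ((BoundedContinuousFunction.evalCLM ℝ t : (ℝ →ᵇ (ι → ℝ)) →L[ℝ] _).continuous.norm) continuous_const
    have hmem : Γ x ∈ s := by
      refine mem_of_contraction_of_isClosed hq1 hNq (hΓeq x) hs ⟨0, fun t _ => ?_⟩
        fun γ hγ t ht => ?_
      · simpa using mul_nonneg hA (Real.exp_pos _).le
      refine (pi_norm_le_iff_of_nonneg (by positivity)).2 fun i => ?_
      have hcl : c < |l i| := hcμ.trans_le (hμl i)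
      have hcont : Continuous fun s => g (γ s) i :=
        (continuous_apply i).comp (hg.continuous.comp γ.continuous)
      have h1 := norm_duhamelFun_le (A := q * A) hcont hc.le hcl (fun s hs => by
        have h2 := hq.norm_sub_le (γ s) 0
        rw [hg0, sub_zero, sub_zero] at h2
        calc ‖g (γ s) i‖ ≤ ‖g (γ s)‖ := norm_le_pi_norm _ i
          _ ≤ q * (A * Real.exp (-c * s)) := h2.trans (by gcongr; exact hγ s hs)
          _ = _ := by ring) ht
      have h3 : ‖stableExp l x t i‖ ≤ ‖x‖ * Real.exp (-c * t) := by
        rw [stableExp_apply, max_eq_left ht]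
        split_ifs with h
        · rw [norm_mul, Real.norm_eq_abs, Real.abs_exp, mul_comm]
          rw [abs_of_neg h] at hcl
          gcongr
          · exact norm_le_pi_norm x i
          · linarith
        · rw [norm_zero]; positivity
      calc ‖(stableExp l x + N γ) t i‖ ≤ ‖stableExp l x t i‖ + ‖N γ t i‖ := norm_add_le _ _
        _ ≤ ‖x‖ * Real.exp (-c * t) + q * A / (|l i| - c) * Real.exp (-c * t) := by
          rw [hNapply, max_eq_left ht]
          exact add_le_add h3 h1
        _ ≤ ‖x‖ * Real.exp (-c * t) + q * A / (μ - c) * Real.exp (-c * t) := by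
          have : 0 < μ - c := by linarith
          gcongr
          exact hμl i
        _ = A * Real.exp (-c * t) := by rw [← add_mul, hAeq]
    have hlim : Tendsto (fun t => A * Real.exp (-c * t)) atTop (𝓝 0) := by
      have : Tendsto (fun t => -c * t) atTop atBot :=
        tendsto_id.const_mul_atTop_of_neg (by linarith)
      simpa using (Real.tendsto_exp_atBot.comp this).const_mul A
    refine squeeze_zero_norm' ?_ hlim
    filter_upwards [eventually_ge_atTop 0] with t ht using hmem t ht
  · have hcy : ContinuousOn y (Ici 0) := fun t ht => (hy t ht).continuousWithinAt
    let Y : ℝ →ᵇ (ι → ℝ) := .ofNormedAddCommGroup (fun t => y (max t 0))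
      (hcy.comp_continuous (by fun_prop) fun t => mem_Ici.2 (le_max_right _ _)) C fun t => hC _ (le_max_right _ _)
    have hYy : ∀ t, 0 ≤ t → Y t = y t := fun t ht => by
      change y (max t 0) = y t
      rw [max_eq_left ht]
    have hY : Γ (y 0) = Y := by
      refine (hSeq _ _).2 ?_
      ext t i
      have h1 := eq_duhamel_of_bounded (hl i) (y := fun t => y t i)
        (h := (ContinuousLinearMap.proj (R := ℝ) (φ := fun _ : ι => ℝ) i).compLeftContinuousBounded
          ℝ (nemytskii gc Y)) (C := C) (fun t ht => (norm_le_pi_norm _ i).trans (hC t ht))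
        (fun t ht => by
          have := hasDerivWithinAt_pi.1 (hy t ht) i
          rw [← hYy t ht] at this ⊢
          exact this) (le_max_right t 0)
      rw [BoundedContinuousFunction.coe_add, Pi.add_apply, Pi.add_apply, stableExp_apply,
        hNapply]
      rw [duhamel_apply, max_eq_left (le_max_right t 0)] at h1
      exact h1
    rw [hY, hYy t ht]
  · let gi : C(ι → ℝ, ℝ) := ⟨fun x => g x i, by have := hg.continuous; fun_prop⟩
    have hgis : ContDiff ℝ ∞ gi := contDiff_pi.1 hg i
    let gi' : C(ι → ℝ, (ι → ℝ) →L[ℝ] ℝ) := ⟨fderiv ℝ gi, hgis.continuous_fderiv (by simp)⟩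
    have h1 := hasFDerivAt_nemytskii gi gi'
      (fun x => (hgis.differentiable (by simp) x).hasFDerivAt) (Γ 0)
    have h2 : nemytskii gi' (Γ 0) = 0 := by
      ext t : 1
      rw [hΓ0]
      exact hgi
    rw [h2, map_zero] at h1
    have h3 := (hΓ.differentiable (by simp) 0).hasFDerivAt
    have h4 := ((BoundedContinuousFunction.evalCLM ℝ (0 : ℝ) : (ℝ →ᵇ ℝ) →L[ℝ] ℝ).comp
      (duhamel ℝ (hl i))).hasFDerivAt.comp 0 (h1.comp 0 h3)
    rw [ContinuousLinearMap.zero_comp, ContinuousLinearMap.comp_zero] at h4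
    refine h4.congr_of_eventuallyEq (Eventually.of_forall fun x => ?_)
    simp only [hΓapply, if_neg hi.not_gt, zero_add]
    rfl

end Perron

/-! ### Straightening of submanifolds and tangent vectors -/

section Submanifold

variable {n k : ℕ}

/-- The coordinate subspace `ℝᵏ × {0}` of `ℝⁿ`. -/
def coordSubspace (n k : ℕ) : Set (Fin n → ℝ) := {x | ∀ i : Fin n, k ≤ (i : ℕ) → x i = 0}

theorem isSmoothSubmanifold_coordSubspace (hk : k ≤ n) :
    IsSmoothSubmanifold k (coordSubspace n k) :=
  ⟨hk, fun _ _ => ⟨OpenPartialHomeomorph.refl _, mem_univ _, contDiffOn_id, contDiffOn_id,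
    fun _ _ => Iff.rfl⟩⟩

theorem IsSmoothSubmanifold.of_locally_preimage {S S' : Set (Fin n → ℝ)}
    (hS' : IsSmoothSubmanifold k S')
    (h : ∀ x ∈ S, ∃ (O : Set (Fin n → ℝ)) (Φ : (Fin n → ℝ) ≃ₜ (Fin n → ℝ)), IsOpen O ∧ x ∈ O ∧
      ContDiff ℝ ∞ Φ ∧ ContDiff ℝ ∞ Φ.symm ∧ ∀ y ∈ O, y ∈ S ↔ Φ y ∈ S') :
    IsSmoothSubmanifold k S := by
  refine ⟨hS'.1, fun x hx => ?_⟩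
  obtain ⟨O, Φ, hO, hxO, hΦ, hΦ', hiff⟩ := h x hx
  obtain ⟨Ψ, hxΨ, hΨ, hΨ', hiff'⟩ := hS'.2 (Φ x) ((hiff x hxO).1 hx)
  refine ⟨(Φ.toOpenPartialHomeomorph.restrOpen O hO).trans Ψ, ?_, ?_, ?_, fun y hy => ?_⟩
  · simp [hxO, hxΨ]
  · exact hΨ.comp hΦ.contDiffOn fun y hy => by simp at hy; exact hy.2
  · exact hΦ'.comp_contDiffOn (hΨ'.mono fun y hy => by simp at hy; exact hy.1)
  · simp at hy
    rw [hiff y hy.1, hiff' _ hy.2]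
    simp

theorem tangentVectors_inter_of_isOpen {S O : Set (Fin n → ℝ)} {p : Fin n → ℝ} (hO : IsOpen O)
    (hp : p ∈ O) : tangentVectors (S ∩ O) p = tangentVectors S p := by
  ext v
  constructor
  · rintro ⟨c, h0, hc, hS⟩
    exact ⟨c, h0, hc, hS.mono fun t ht => ht.1⟩
  · rintro ⟨c, h0, hc, hS⟩
    exact ⟨c, h0, hc, hS.and (hc.continuousAt.eventually_mem (hO.mem_nhds (h0 ▸ hp)))⟩

theorem tangentVectors_preimage_coordSubspace {Ψ : (Fin n → ℝ) ≃ₜ (Fin n → ℝ)} {p : Fin n → ℝ}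
    {L : (Fin n → ℝ) ≃L[ℝ] (Fin n → ℝ)} (hp : Ψ p = 0)
    (hΨ : HasFDerivAt Ψ (L.symm : (Fin n → ℝ) →L[ℝ] (Fin n → ℝ)) p)
    (hΨ' : HasFDerivAt Ψ.symm (L : (Fin n → ℝ) →L[ℝ] (Fin n → ℝ)) 0) :
    tangentVectors (Ψ ⁻¹' coordSubspace n k) p = L '' coordSubspace n k := by
  ext v
  constructor
  · rintro ⟨c, h0, hc, hS⟩
    refine ⟨L.symm v, fun i hi => ?_, by simp⟩
    subst h0
    have h1 := hasDerivAt_pi.1 (hΨ.comp_hasDerivAt 0 hc) i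
    exact h1.unique ((hasDerivAt_const (0 : ℝ) (0 : ℝ)).congr_of_eventuallyEq
      (hS.mono fun t ht => ht i hi))
  · rintro ⟨w, hw, rfl⟩
    have h1 : HasDerivAt (fun t : ℝ => t • w) w 0 := by
      simpa using (hasDerivAt_id (0 : ℝ)).smul_const w
    refine ⟨fun t => Ψ.symm (t • w), ?_, ?_, Eventually.of_forall fun t i hi => ?_⟩
    · simp [← hp]
    · rw [← zero_smul ℝ w] at hΨ'
      exact hΨ'.comp_hasDerivAt (0 : ℝ) h1
    · rw [Ψ.apply_symm_apply, Pi.smul_apply, hw i hi, smul_zero]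

end Submanifold

/-! ### Sets of initial data of convergent solutions -/

section StableSets

variable {E : Type*} [NormedAddCommGroup E] [NormedSpace ℝ E]

/-- `γ` is a solution of `γ' = f γ` on `[0, ∞)` with values in `V`. -/
def IsForwardSolutionIn (f : E → E) (V : Set E) (γ : ℝ → E) : Prop :=
  ∀ s : ℝ, 0 ≤ s → γ s ∈ V ∧ HasDerivWithinAt γ (f (γ s)) (Ici 0) s

/-- The initial data of the solutions in `V` on `[0, ∞)` which converge to `p` and stay in `U` from
the time `T` on. -/
def stableSetIn (f : E → E) (V : Set E) (p : E) (U : Set E) (T : ℝ) : Set E :=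
  {x | ∃ γ : ℝ → E, IsForwardSolutionIn f V γ ∧ γ 0 = x ∧ Tendsto γ atTop (𝓝 p) ∧
    ∀ s, T ≤ s → γ s ∈ U}

variable {f : E → E} {V U : Set E} {p : E}

theorem IsForwardSolutionIn.restrict {γ : ℝ → E} (hγ : IsForwardSolutionIn f V γ) (T : ℝ) :
    ∀ t ∈ Icc 0 T, γ t ∈ V ∧ HasDerivWithinAt γ (f (γ t)) (Icc 0 T) t := fun t ht =>
  ⟨(hγ t ht.1).1, (hγ t ht.1).2.mono Icc_subset_Ici_self⟩

theorem stableSetIn_mono {T T' : ℝ} (h : T ≤ T') :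
    stableSetIn f V p U T ⊆ stableSetIn f V p U T' := by
  rintro x ⟨γ, h1, h2, h3, h4⟩
  exact ⟨γ, h1, h2, h3, fun s hs => h4 s (h.trans hs)⟩

theorem exists_mem_stableSetIn (hU : U ∈ 𝓝 p) {γ : ℝ → E} (hγ : IsForwardSolutionIn f V γ)
    (hlim : Tendsto γ atTop (𝓝 p)) : ∃ T, 0 ≤ T ∧ γ 0 ∈ stableSetIn f V p U T := by
  obtain ⟨T, hT⟩ := eventually_atTop.1 (hlim.eventually_mem hU)
  exact ⟨max T 0, le_max_right _ _, γ, hγ, rfl, hlim, fun s hs => hT s ((le_max_left _ _).trans hs)⟩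

theorem IsForwardSolutionIn.shift {γ : ℝ → E} (hγ : IsForwardSolutionIn f V γ) {T : ℝ}
    (hT : 0 ≤ T) : IsForwardSolutionIn f V fun s => γ (s + T) := by
  intro s hs
  refine ⟨(hγ (s + T) (by linarith)).1, ?_⟩
  have hm : MapsTo (fun s => s + T) (Ici 0) (Ici 0) := fun s hs => by
    have : 0 ≤ s := hs
    exact mem_Ici.2 (by linarith)
  have h := (hγ (s + T) (by linarith)).2.scomp s
    ((hasDerivAt_id s).add_const T).hasDerivWithinAt hm
  simpa [Function.comp_def] using h

/-- Concatenation of a solution on `[0, T]` with a forward solution starting at its endpoint. -/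
theorem isForwardSolutionIn_concat {φ γ : ℝ → E} {T : ℝ} (hT : 0 ≤ T)
    (hφ : ∀ t ∈ Icc 0 T, φ t ∈ V ∧ HasDerivWithinAt φ (f (φ t)) (Icc 0 T) t)
    (hγ : IsForwardSolutionIn f V γ) (h : φ T = γ 0) :
    IsForwardSolutionIn f V fun s => if s ≤ T then φ s else γ (s - T) := by
  set η : ℝ → E := fun s => if s ≤ T then φ s else γ (s - T) with hη
  have hη1 : ∀ s, s ≤ T → η s = φ s := fun s hs => if_pos hs
  have hη2 : ∀ s, T ≤ s → η s = γ (s - T) := fun s hs => by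
    rcases hs.eq_or_lt with rfl | hs
    · rw [hη1 _ le_rfl, h, sub_self]
    · exact if_neg hs.not_ge
  have hd2 : ∀ s, T ≤ s → HasDerivWithinAt η (f (η s)) (Ici T) s := by
    intro s hs
    have hm : MapsTo (fun s => s - T) (Ici T) (Ici 0) := fun s hs => by
      have : T ≤ s := hs
      exact mem_Ici.2 (by linarith)
    have h := (hγ (s - T) (by linarith)).2.scomp s
      ((hasDerivAt_id s).sub_const T).hasDerivWithinAt hm
    rw [hη2 s hs]
    refine (h.congr_deriv (by simp)).congr (fun u hu => hη2 u hu) (hη2 s hs)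
  have hd1 : ∀ s ∈ Icc 0 T, HasDerivWithinAt η (f (η s)) (Icc 0 T) s := by
    intro s hs
    rw [hη1 s hs.2]
    exact (hφ s hs).2.congr (fun u hu => hη1 u hu.2) (hη1 s hs.2)
  intro s hs
  constructor
  · rcases le_total s T with h' | h'
    · rw [hη1 s h']; exact (hφ s ⟨hs, h'⟩).1
    · rw [hη2 s h']; exact (hγ _ (by linarith)).1
  · rcases lt_trichotomy s T with h' | h' | h'
    · exact (hd1 s ⟨hs, h'.le⟩).mono_of_mem_nhdsWithin (by
        rw [← Ici_inter_Iic]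
        exact inter_mem_nhdsWithin _ (Iic_mem_nhds h'))
    · have := (hd1 s ⟨hs, h'.le⟩).union (hd2 s h'.ge)
      rwa [Icc_union_Ici_eq_Ici hT] at this
    · exact (hd2 s h'.le).mono_of_mem_nhdsWithin (mem_nhdsWithin_of_mem_nhds (Ici_mem_nhds h'))

variable [FiniteDimensional ℝ E]

/-- Staying in an open set during a compact time interval is an open condition on initial data. -/
theorem exists_isOpen_stableSetIn_eq_inter (hV : IsOpen V) (hf : ContDiffOn ℝ ∞ f V)
    (hU : IsOpen U) {T T' : ℝ} (hT : 0 ≤ T) (hTT' : T ≤ T') :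
    ∃ O : Set E, IsOpen O ∧ stableSetIn f V p U T = stableSetIn f V p U T' ∩ O := by
  have key : ∀ x ∈ stableSetIn f V p U T, ∃ O : Set E, IsOpen O ∧ x ∈ O ∧
      stableSetIn f V p U T' ∩ O ⊆ stableSetIn f V p U T := by
    rintro x ⟨γ, h1, rfl, h3, h4⟩
    have hK : IsCompact (γ '' Icc T T') := isCompact_Icc.image_of_continuousOn fun t ht =>
      (h1 t (hT.trans ht.1)).2.continuousWithinAt.mono fun s hs => hT.trans hs.1
    obtain ⟨ε, hε, hεU⟩ := hK.exists_thickening_subset_open hU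
      (image_subset_iff.2 fun t ht => h4 t ht.1)
    obtain ⟨O, φ, Φ, hO, hxO, -, -, h0, h5⟩ := exists_flowBox hV hf (hT.trans hTT')
      (h1.restrict T') hε
    refine ⟨O, hO, hxO, ?_⟩
    rintro y ⟨⟨η, g1, rfl, g3, g4⟩, hyO⟩
    refine ⟨η, g1, rfl, g3, fun s hs => ?_⟩
    rcases le_total T' s with h | h
    · exact g4 s h
    · have hs' : s ∈ Icc 0 T' := ⟨hT.trans hs, h⟩
      have hEq := eqOn_of_solution hV hf (g1.restrict T') (fun t ht => (h5 _ hyO t ht).2)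
        (h0 (η 0)).1.symm hs'
      rw [hEq]
      exact hεU (Metric.mem_thickening_iff.2
        ⟨γ s, mem_image_of_mem _ ⟨hs, h⟩, (h5 _ hyO s hs').1⟩)
  choose! O hO hxO hsub using key
  refine ⟨⋃ x ∈ stableSetIn f V p U T, O x, isOpen_biUnion hO, Subset.antisymm (fun x hx =>
    ⟨stableSetIn_mono hTT' hx, mem_biUnion hx (hxO x hx)⟩) ?_⟩
  rintro y ⟨hy, hyO⟩
  obtain ⟨x, hx, hyx⟩ := mem_iUnion₂.1 hyO
  exact hsub x hx ⟨hy, hyx⟩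

/-- Near each of its points, `stableSetIn f V p U T` is the preimage of `stableSetIn f V p U 0`
under a diffeomorphism, namely the time-`T` map of the flow. -/
theorem exists_mem_stableSetIn_iff (hV : IsOpen V) (hf : ContDiffOn ℝ ∞ f V) {T : ℝ} (hT : 0 ≤ T)
    {x : E} (hx : x ∈ stableSetIn f V p U T) :
    ∃ (O : Set E) (Φ : E ≃ₜ E), IsOpen O ∧ x ∈ O ∧ ContDiff ℝ ∞ Φ ∧ ContDiff ℝ ∞ Φ.symm ∧
      ∀ y ∈ O, y ∈ stableSetIn f V p U T ↔ Φ y ∈ stableSetIn f V p U 0 := by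
  obtain ⟨γ, h1, rfl, h3, h4⟩ := hx
  obtain ⟨O, φ, Φ, hO, hxO, hΦ, hΦ', h0, h5⟩ := exists_flowBox hV hf hT (h1.restrict T) one_pos
  refine ⟨O, Φ, hO, hxO, hΦ, hΦ', fun y hy => ⟨?_, ?_⟩⟩
  · rintro ⟨η, g1, rfl, g3, g4⟩
    have hEq := eqOn_of_solution hV hf (g1.restrict T) (fun t ht => (h5 _ hy t ht).2)
      (h0 (η 0)).1.symm ⟨hT, le_rfl⟩
    refine ⟨fun s => η (s + T), g1.shift hT, ?_,
      g3.comp (tendsto_atTop_add_const_right _ T tendsto_id), fun s hs => g4 _ (by linarith)⟩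
    simp only [zero_add, hEq, (h0 _).2]
  · rintro ⟨η, g1, g2, g3, g4⟩
    refine ⟨_, isForwardSolutionIn_concat hT (fun t ht => (h5 _ hy t ht).2) g1
      ((h0 y).2.trans g2.symm), ?_, ?_, fun s hs => ?_⟩
    · rw [if_pos hT, (h0 y).1]
    · refine (g3.comp (tendsto_atTop_add_const_right _ (-T) tendsto_id)).congr' ?_
      filter_upwards [eventually_gt_atTop T] with s hs
      rw [if_neg hs.not_ge]
      rfl
    · rcases hs.eq_or_lt with rfl | hs
      · rw [if_pos le_rfl, (h0 y).2, ← g2]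
        exact g4 0 le_rfl
      · rw [if_neg hs.not_ge]
        exact g4 _ (by linarith)

end StableSets

/-! ### The stable manifold theorem -/

section StableManifold

open scoped NNReal

/-- A smooth map vanishing to first order at `0` agrees near `0` with a globally defined smooth map
of arbitrarily small Lipschitz constant. The latter is obtained by composition with the rescalings
`x ↦ r • ρ (r⁻¹ • x)` of a bounded smooth map `ρ` which is the identity near `0`; their Lipschitz
constants do not depend on `r`. -/
theorem exists_contDiff_lipschitz_eqOn_ball {E F : Type*} [NormedAddCommGroup E] [NormedSpace ℝ E]
    [FiniteDimensional ℝ E] [NormedAddCommGroup F] [NormedSpace ℝ F] {R : E → F} {V : Set E}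
    (hV : IsOpen V) (h0 : (0 : E) ∈ V) (hR : ContDiffOn ℝ ∞ R V) (hR' : fderiv ℝ R 0 = 0)
    {ε : ℝ≥0} (hε : 0 < ε) :
    ∃ (R' : E → F) (r : ℝ), 0 < r ∧ ContDiff ℝ ∞ R' ∧ LipschitzWith ε R' ∧
      EqOn R' R (Metric.ball 0 r) := by
  let χ : ContDiffBump (0 : E) := ⟨1, 2, one_pos, one_lt_two⟩
  let ρ : E → E := fun x => χ x • x
  have hρ : ContDiff ℝ ∞ ρ := χ.contDiff.smul contDiff_id
  have hρs : HasCompactSupport ρ := χ.hasCompactSupport.smul_right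
  obtain ⟨C, hC⟩ := ContDiff.lipschitzWith_of_hasCompactSupport hρs hρ (by simp)
  have hρ2 : ∀ x, ‖ρ x‖ ≤ 2 := fun x => by
    by_cases hx : ‖x‖ < 2
    · rw [norm_smul, Real.norm_of_nonneg χ.nonneg]
      nlinarith [χ.nonneg (x := x), χ.le_one (x := x), norm_nonneg x]
    · have : χ x = 0 := χ.zero_of_le_dist (by simpa using not_lt.1 hx)
      simp [ρ, this]
  have hcont : ContinuousAt (fderiv ℝ R) 0 :=
    (hR.continuousOn_fderiv_of_isOpen hV (by simp)).continuousAt (hV.mem_nhds h0)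
  have hsmall : ∀ᶠ x in 𝓝 (0 : E), ‖fderiv ℝ R x‖₊ < ε / (C + 1) := by
    refine hcont.nnnorm.eventually_lt_const ?_
    simp only [hR', nnnorm_zero]
    positivity
  obtain ⟨δ, hδ, hball⟩ := Metric.eventually_nhds_iff_ball.1 (hsmall.and (hV.mem_nhds h0))
  have hlip : LipschitzOnWith (ε / (C + 1)) R (Metric.ball 0 δ) :=
    (convex_ball 0 δ).lipschitzOnWith_of_nnnorm_fderiv_le
      (fun x hx => ((hR.contDiffAt (hV.mem_nhds (hball x hx).2)).differentiableAt (by simp)))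
      fun x hx => (hball x hx).1.le
  let r : ℝ := δ / 3
  have hr : 0 < r := by positivity
  let σ : E → E := fun x => r • ρ (r⁻¹ • x)
  have hσ : ContDiff ℝ ∞ σ := contDiff_const.smul (hρ.comp (contDiff_const.smul contDiff_id))
  have hσm : ∀ x, σ x ∈ Metric.ball (0 : E) δ := fun x => by
    rw [mem_ball_zero_iff, norm_smul, Real.norm_of_nonneg hr.le]
    have := hρ2 (r⁻¹ • x)
    have : r * ‖ρ (r⁻¹ • x)‖ ≤ r * 2 := by gcongr
    simp only [r] at this hr ⊢
    linarith
  have hσL : LipschitzWith C σ := LipschitzWith.of_dist_le_mul fun x y => by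
    rw [dist_eq_norm, dist_eq_norm, ← smul_sub, norm_smul, Real.norm_of_nonneg hr.le]
    have := hC.norm_sub_le (r⁻¹ • x) (r⁻¹ • y)
    rw [← smul_sub, norm_smul, norm_inv, Real.norm_of_nonneg hr.le] at this
    calc _ ≤ r * (C * (r⁻¹ * ‖x - y‖)) := by gcongr
      _ = C * ‖x - y‖ := by field_simp
  refine ⟨R ∘ σ, r, hr, ?_, ?_, fun x hx => ?_⟩
  · rw [contDiff_iff_contDiffAt]
    exact fun x => ContDiffAt.comp x (hR.contDiffAt (hV.mem_nhds (hball _ (hσm x)).2))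
      hσ.contDiffAt
  · have h1 := hlip.comp (hσL.lipschitzOnWith (s := univ)) fun x _ => hσm x
    rw [lipschitzOnWith_univ] at h1
    refine h1.weaken ?_
    rw [div_mul_eq_mul_div, div_le_iff₀ (by positivity)]
    gcongr
    exact le_self_add
  · have : χ (r⁻¹ • x) = 1 := χ.one_of_mem_closedBall (by
      rw [mem_closedBall_zero_iff, norm_smul, norm_inv, Real.norm_of_nonneg hr.le,
        inv_mul_le_iff₀ hr]
      simpa [χ] using (mem_ball_zero_iff.1 hx).le)
    simp [σ, ρ, this, smul_smul, hr.ne']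

/-- A strict pointwise bound on the half-line is strict for the supremum if the function tends to zero. -/
theorem norm_lt_of_tendsto_zero {E : Type*} [NormedAddCommGroup E] {γ : ℝ →ᵇ E} {r : ℝ}
    (hr : 0 < r) (hlim : Tendsto γ atTop (𝓝 0)) (hneg : ∀ t ≤ 0, γ t = γ 0)
    (hlt : ∀ t, 0 ≤ t → ‖γ t‖ < r) : ‖γ‖ < r := by
  have h1 : ∀ᶠ t in atTop, ‖γ t‖ < r / 2 := by
    have := hlim.norm
    rw [norm_zero] at this
    exact this.eventually_lt_const (by positivity)
  obtain ⟨T, hT⟩ := eventually_atTop.1 h1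
  obtain ⟨t₀, ht₀, hmax⟩ := (isCompact_Icc (a := (0 : ℝ)) (b := max T 0)).exists_isMaxOn
    ⟨0, le_rfl, le_max_right _ _⟩ (γ.continuous.norm.continuousOn)
  refine lt_of_le_of_lt ((BoundedContinuousFunction.norm_le (C := max (r / 2) ‖γ t₀‖)
    (by positivity)).2 fun t => ?_) (max_lt (by linarith) (hlt t₀ ht₀.1))
  rcases le_total t 0 with h | h
  · rw [hneg t h]
    exact le_max_of_le_right (hmax ⟨le_rfl, le_max_right _ _⟩)
  · rcases le_total t (max T 0) with h' | h'
    · exact le_max_of_le_right (hmax ⟨h, h'⟩)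
    · exact le_max_of_le_left (hT t ((le_max_left _ _).trans h')).le

/-- The local stable manifold of a hyperbolic equilibrium `p` of a `C^∞` field, whose linearisation
in the coordinates `L` is a diagonal map `l` up to a small perturbation `N` in the stable
directions. It is the level set, given by a diffeomorphism `Ψ`, of the initial values of the bounded
solutions; the diffeomorphism differs from the coordinates `L` to second order at `p` only. -/
theorem exists_local_stable_manifold {n k : ℕ} {f : (Fin n → ℝ) → (Fin n → ℝ)}
    {V : Set (Fin n → ℝ)} {p : Fin n → ℝ} (hV : IsOpen V) (hpV : p ∈ V) (hf : ContDiffOn ℝ ∞ f V)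
    (hfp : f p = 0) (L : (Fin n → ℝ) ≃L[ℝ] (Fin n → ℝ)) {l : Fin n → ℝ} {μ : ℝ}
    (hl : ∀ i, l i < 0 ↔ (i : ℕ) < k) (hμl : ∀ i, μ ≤ |l i|)
    {N : (Fin n → ℝ) →L[ℝ] (Fin n → ℝ)} (hN : ‖N‖ < μ)
    (hNu : ∀ z, ∀ i : Fin n, k ≤ (i : ℕ) → N z i = 0)
    (hlin : ∀ z, fderiv ℝ f p (L z) = L (l * z + N z)) {W : Set (Fin n → ℝ)} (hW : W ∈ 𝓝 p) :
    ∃ (U O : Set (Fin n → ℝ)) (Ψ : (Fin n → ℝ) ≃ₜ (Fin n → ℝ)), U ⊆ W ∧ IsOpen U ∧ p ∈ U ∧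
      IsOpen O ∧ p ∈ O ∧ ContDiff ℝ ∞ Ψ ∧ ContDiff ℝ ∞ Ψ.symm ∧ Ψ p = 0 ∧
      HasFDerivAt Ψ (L.symm : (Fin n → ℝ) →L[ℝ] (Fin n → ℝ)) p ∧
      HasFDerivAt Ψ.symm (L : (Fin n → ℝ) →L[ℝ] (Fin n → ℝ)) 0 ∧
      stableSetIn f V p U 0 = Ψ ⁻¹' coordSubspace n k ∩ O := by
  have hμ : 0 < μ := (norm_nonneg N).trans_lt hN
  have hlu : ∀ i : Fin n, k ≤ (i : ℕ) → 0 < l i := fun i hi => by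
    have h1 : ¬ l i < 0 := fun h => absurd ((hl i).1 h) (by omega)
    rcases (not_lt.1 h1).eq_or_lt with h | h
    · have := hμl i
      rw [← h, abs_zero] at this
      linarith
    · exact h
  -- the vector field in the coordinates `z`, minus its linear part
  let R : (Fin n → ℝ) → (Fin n → ℝ) := fun z => L.symm (f (p + L z)) - (l * z + N z)
  let V' : Set (Fin n → ℝ) := (fun z => p + L z) ⁻¹' V
  have haff : ContDiff ℝ ∞ fun z => p + L z := contDiff_const.add L.contDiff
  have hV' : IsOpen V' := hV.preimage haff.continuous
  have h0V' : (0 : Fin n → ℝ) ∈ V' := by simpa [V'] using hpV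
  let D : (Fin n → ℝ) →L[ℝ] (Fin n → ℝ) := ContinuousLinearMap.mul ℝ (Fin n → ℝ) l
  have hD : ∀ z, D z = l * z := fun z => rfl
  have hR : ContDiffOn ℝ ∞ R V' :=
    (L.symm.contDiff.comp_contDiffOn (hf.comp haff.contDiffOn fun z hz => hz)).sub
      (D.contDiff.add N.contDiff).contDiffOn
  have hR0 : R 0 = 0 := by simp [R, hfp]
  have hRd : HasFDerivAt R (0 : (Fin n → ℝ) →L[ℝ] (Fin n → ℝ)) 0 := by
    have h1 : HasFDerivAt f (fderiv ℝ f p) (p + L 0) := by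
      rw [map_zero, add_zero]
      exact ((hf.contDiffAt (hV.mem_nhds hpV)).differentiableAt (by simp)).hasFDerivAt
    have h2 : HasFDerivAt (fun z => p + L z) (L : (Fin n → ℝ) →L[ℝ] (Fin n → ℝ)) 0 :=
      L.hasFDerivAt.const_add p
    have h3 := (L.symm.hasFDerivAt.comp (0 : Fin n → ℝ) (h1.comp 0 h2)).sub
      (D.hasFDerivAt.add N.hasFDerivAt)
    refine h3.congr_fderiv ?_
    ext1 z
    simp [hlin, hD]
  obtain ⟨R', r₀, hr₀, hR's, hR'L, hR'R⟩ := exists_contDiff_lipschitz_eqOn_ball hV' h0V' hR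
    hRd.fderiv (ε := ((μ - ‖N‖) / 2).toNNReal) (by simpa using hN)
  let g : (Fin n → ℝ) → (Fin n → ℝ) := fun z => N z + R' z
  have hR'0 : R' 0 = 0 := by rw [hR'R (Metric.mem_ball_self hr₀), hR0]
  have hg : ContDiff ℝ ∞ g := N.contDiff.add hR's
  have hgL : LipschitzWith (‖N‖₊ + ((μ - ‖N‖) / 2).toNNReal) g := N.lipschitz.add hR'L
  have hgμ : ((‖N‖₊ + ((μ - ‖N‖) / 2).toNNReal : ℝ≥0) : ℝ) < μ := by
    rw [NNReal.coe_add, coe_nnnorm, Real.coe_toNNReal _ (by linarith)]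
    linarith
  have hgd : ∀ i : Fin n, k ≤ (i : ℕ) → fderiv ℝ (fun x => g x i) 0 = 0 := by
    intro i hi
    have h1 : HasFDerivAt R' (0 : (Fin n → ℝ) →L[ℝ] (Fin n → ℝ)) 0 := hRd.congr_of_eventuallyEq
      (hR'R.eventuallyEq_of_mem (Metric.ball_mem_nhds 0 hr₀))
    have h3 : HasFDerivAt g (N + 0) 0 := N.hasFDerivAt.add h1
    have h2 := hasFDerivAt_pi'.1 h3 i
    rw [HasFDerivAt.fderiv h2]
    ext1 z
    simp [hNu z i hi]
  obtain ⟨Γ, hΓ, hΓ0, hΓst, hΓs, hΓneg, hΓsol, hΓlim, hΓuniq, hΓd⟩ :=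
    exists_bounded_solutions hμl hg (by simp [g, hR'0]) hgL hgμ
  -- the straightening of the graph of the unstable coordinates
  let H : (Fin n → ℝ) → (Fin n → ℝ) := fun z i => if l i < 0 then 0 else Γ z 0 i
  have hHst : ∀ {z w : Fin n → ℝ}, (∀ i, l i < 0 → z i = w i) → H z = H w := fun h => by
    simp only [H, hΓst _ _ h]
  have hH : ContDiff ℝ ∞ H := by
    refine contDiff_pi.2 fun i => ?_
    simp only [H]
    split_ifs with h
    · exact contDiff_const
    · exact contDiff_pi.1 ((BoundedContinuousFunction.evalCLM ℝ (0 : ℝ) :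
        (ℝ →ᵇ (Fin n → ℝ)) →L[ℝ] _).contDiff.comp hΓ) i
  have hH0 : H 0 = 0 := by
    ext i
    simp [H, hΓ0]
  have hHd : HasFDerivAt H (0 : (Fin n → ℝ) →L[ℝ] (Fin n → ℝ)) 0 := by
    refine hasFDerivAt_pi'.2 fun i => ?_
    rw [ContinuousLinearMap.comp_zero]
    simp only [H]
    split_ifs with h
    · exact hasFDerivAt_const _ _
    · have hi : k ≤ (i : ℕ) := by
        by_contra hc
        exact h ((hl i).2 (by omega))
      exact hΓd i (hlu i hi) (hgd i hi)
  have hHsub : ∀ z, H (z - H z) = H z := fun z => hHst fun i hi => by simp [H, hi]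
  have hHadd : ∀ z, H (z + H z) = H z := fun z => hHst fun i hi => by simp [H, hi]
  have hHs : ∀ {z : Fin n → ℝ}, Γ z 0 = z ↔ z - H z ∈ coordSubspace n k := by
    intro z
    constructor
    · intro h i hi
      rw [Pi.sub_apply]
      simp only [H]
      rw [if_neg (hlu i hi).not_gt, h, sub_self]
    · intro h
      ext i
      by_cases hi : l i < 0
      · exact hΓs z i hi
      · have h1 := h i (by by_contra hc; exact hi ((hl i).2 (by omega)))
        simp only [Pi.sub_apply, H, if_neg hi] at h1
        linarith
  let c : (Fin n → ℝ) → (Fin n → ℝ) := fun x => L.symm (x - p)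
  have hc : ContDiff ℝ ∞ c := L.symm.contDiff.comp (contDiff_id.sub contDiff_const)
  have hcd : HasFDerivAt c (L.symm : (Fin n → ℝ) →L[ℝ] (Fin n → ℝ)) p :=
    L.symm.hasFDerivAt.comp p ((hasFDerivAt_id p).sub_const p)
  have hcp : c p = 0 := by simp [c]
  have hLc : ∀ x, p + L (c x) = x := fun x => by simp [c]
  have hcL : ∀ z, c (p + L z) = z := fun z => by simp [c]
  have hF : ContDiff ℝ ∞ fun x => c x - H (c x) := hc.sub (hH.comp hc)
  have hF' : ContDiff ℝ ∞ fun w => p + L (w + H w) :=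
    haff.comp (contDiff_id.add hH)
  let Ψ : (Fin n → ℝ) ≃ₜ (Fin n → ℝ) :=
    ⟨⟨fun x => c x - H (c x), fun w => p + L (w + H w), fun x => by
        beta_reduce
        rw [hHsub, sub_add_cancel, hLc], fun w => by
        beta_reduce
        rw [hcL, hHadd, add_sub_cancel_right]⟩, hF.continuous, hF'.continuous⟩
  -- the neighbourhood is a ball of small radius `r` in the coordinates `z`
  obtain ⟨r, hr, hrW, hrr₀⟩ : ∃ r, 0 < r ∧ (∀ z, ‖z‖ < r → p + L z ∈ W ∩ V) ∧ r ≤ r₀ := by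
    have h1 : (fun z => p + L z) ⁻¹' (W ∩ V) ∈ 𝓝 (0 : Fin n → ℝ) := by
      refine haff.continuous.continuousAt.preimage_mem_nhds ?_
      rw [map_zero, add_zero]
      exact inter_mem hW (hV.mem_nhds hpV)
    obtain ⟨r, hr, h2⟩ := Metric.mem_nhds_iff.1 h1
    exact ⟨min r r₀, lt_min hr hr₀, fun z hz => h2 (mem_ball_zero_iff.2
      (hz.trans_le (min_le_left _ _))), min_le_right _ _⟩
  have hfL : ∀ z, ‖z‖ < r → f (p + L z) = L (l * z + g z) := by
    intro z hz
    have h1 := hR'R (mem_ball_zero_iff.2 (hz.trans_le hrr₀))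
    simp only [g, h1, R]
    rw [← L.symm_apply_eq]
    abel
  refine ⟨{x | ‖c x‖ < r}, {x | ‖Γ (c x)‖ < r}, Ψ, fun x hx => ?_,
    isOpen_lt hc.continuous.norm continuous_const, by simpa [hcp] using hr,
    isOpen_lt (hΓ.continuous.comp hc.continuous).norm continuous_const,
    by simpa [hcp, hΓ0] using hr, hF, hF', ?_, ?_, ?_, ?_⟩
  · have := (hrW _ hx).1
    rwa [hLc] at this
  · change c p - H (c p) = 0
    rw [hcp, hH0, sub_zero]
  · have h1 : HasFDerivAt H (0 : (Fin n → ℝ) →L[ℝ] (Fin n → ℝ)) (c p) := by rw [hcp]; exact hHd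
    exact (hcd.sub (h1.comp p hcd)).congr_fderiv (by simp)
  · have h1 := (L.hasFDerivAt.comp (0 : Fin n → ℝ)
      ((hasFDerivAt_id (0 : Fin n → ℝ)).add hHd)).const_add p
    exact h1.congr_fderiv (by ext1 z; simp)
  · ext x
    constructor
    · rintro ⟨γ, h1, rfl, h3, h4⟩
      have hy : ∀ t, 0 ≤ t → HasDerivWithinAt (fun t => c (γ t))
          (l * c (γ t) + g (c (γ t))) (Ici 0) t := by
        intro t ht
        have h5 := L.symm.hasFDerivAt.comp_hasDerivWithinAt t ((h1 t ht).2.sub_const p)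
        refine h5.congr_deriv ?_
        have h6 := hfL _ (h4 t ht)
        rw [hLc] at h6
        rw [h6]
        simp
      have hΓγ := hΓuniq (fun t => c (γ t)) r (fun t ht => (h4 t ht).le) hy
      exact ⟨hHs.1 (hΓγ 0 le_rfl).symm, norm_lt_of_tendsto_zero hr (hΓlim _) (hΓneg _)
        fun t ht => by rw [← hΓγ t ht]; exact h4 t ht⟩
    · rintro ⟨h1, h2⟩
      have h2 : ‖Γ (c x)‖ < r := h2
      have hlt : ∀ t, ‖Γ (c x) t‖ < r := fun t => ((Γ (c x)).norm_coe_le_norm t).trans_lt h2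
      refine ⟨fun t => p + L (Γ (c x) t), fun t ht => ⟨(hrW _ (hlt t)).2, ?_⟩, ?_, ?_,
        fun t _ => ?_⟩
      · rw [hfL _ (hlt t)]
        exact (L.hasFDerivAt.comp_hasDerivWithinAt t (hΓsol (c x) t ht)).const_add p
      · change p + L (Γ (c x) 0) = x
        rw [hHs.2 h1, hLc]
      · simpa using ((L.continuous.tendsto 0).comp (hΓlim (c x))).const_add p
      · change ‖c (p + L (Γ (c x) t))‖ < r
        rw [hcL]
        exact hlt t

/-- The stable manifold theorem: the sets `stableSetIn f V p U T` of a hyperbolic equilibrium `p` are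
submanifolds tangent at `p` to the stable subspace `L '' coordSubspace n k`. -/
theorem exists_isSmoothSubmanifold_stableSetIn {n k : ℕ} (hk : k ≤ n)
    {f : (Fin n → ℝ) → (Fin n → ℝ)}
    {V : Set (Fin n → ℝ)} {p : Fin n → ℝ} (hV : IsOpen V) (hpV : p ∈ V) (hf : ContDiffOn ℝ ∞ f V)
    (hfp : f p = 0) (L : (Fin n → ℝ) ≃L[ℝ] (Fin n → ℝ)) {l : Fin n → ℝ} {μ : ℝ}
    (hl : ∀ i, l i < 0 ↔ (i : ℕ) < k) (hμl : ∀ i, μ ≤ |l i|)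
    {N : (Fin n → ℝ) →L[ℝ] (Fin n → ℝ)} (hN : ‖N‖ < μ)
    (hNu : ∀ z, ∀ i : Fin n, k ≤ (i : ℕ) → N z i = 0)
    (hlin : ∀ z, fderiv ℝ f p (L z) = L (l * z + N z)) {W : Set (Fin n → ℝ)} (hW : W ∈ 𝓝 p) :
    ∃ U ⊆ W, IsOpen U ∧ p ∈ U ∧ ∀ T : ℝ, 0 ≤ T →
      IsSmoothSubmanifold k (stableSetIn f V p U T) ∧ p ∈ stableSetIn f V p U T ∧
      tangentVectors (stableSetIn f V p U T) p = L '' coordSubspace n k := by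
  obtain ⟨U, O, Ψ, hUW, hU, hpU, hO, hpO, hΨ, hΨ', hΨp, hd, hd', hM⟩ :=
    exists_local_stable_manifold hV hpV hf hfp L hl hμl hN hNu hlin hW
  have h0 : IsSmoothSubmanifold k (stableSetIn f V p U 0) :=
    (isSmoothSubmanifold_coordSubspace hk).of_locally_preimage fun x hx => by
      rw [hM] at hx ⊢
      exact ⟨O, Ψ, hO, hx.2, hΨ, hΨ', fun y hy => ⟨fun h => h.1, fun h => ⟨h, hy⟩⟩⟩
  have hp0 : p ∈ stableSetIn f V p U 0 := by
    rw [hM]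
    exact ⟨fun i _ => by rw [hΨp]; rfl, hpO⟩
  refine ⟨U, hUW, hU, hpU, fun T hT => ⟨h0.of_locally_preimage fun x hx =>
    exists_mem_stableSetIn_iff hV hf hT hx, stableSetIn_mono hT hp0, ?_⟩⟩
  obtain ⟨O', hO', hEq⟩ := exists_isOpen_stableSetIn_eq_inter (p := p) hV hf hU le_rfl hT
  rw [← tangentVectors_inter_of_isOpen hO' (by rw [hEq] at hp0; exact hp0.2), ← hEq, hM,
    tangentVectors_inter_of_isOpen hO hpO, tangentVectors_preimage_coordSubspace hΨp hd hd']

end StableManifold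

/-! ### The reduced system near its steady state -/

section Reduced

variable {y₀ θ : ℝ}

theorem isOpen_phaseDomain (y₀ : ℝ) : IsOpen (phaseDomain y₀) := by
  have h1 : IsOpen {x : Fin 4 → ℝ | y₀ * Real.exp (x 2) < Real.exp (x 3)} :=
    isOpen_lt (by fun_prop) (by fun_prop)
  have h2 : IsOpen {x : Fin 4 → ℝ | Real.exp (x 3) ^ 2 - (y₀ * Real.exp (x 2)) ^ 2 < 1 - y₀ ^ 2} :=
    isOpen_lt (by fun_prop) (by fun_prop)
  exact h1.inter h2

theorem contDiffOn_reducedField (h0 : 0 < y₀) (θ : ℝ) :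
    ContDiffOn ℝ ∞ (reducedField y₀ θ) (phaseDomain y₀) := by
  intro x hx
  refine ContDiffAt.contDiffWithinAt ?_
  have hpos : 0 < 1 - y₀ ^ 2 - Real.exp (x 3) ^ 2 + (y₀ * Real.exp (x 2)) ^ 2 := by
    linarith [hx.2]
  have hD0 : zetaDisc y₀ (x 2) (x 3) ≠ 0 := (Real.sqrt_pos.2 hpos).ne'
  have hden : Real.exp (x 3) ^ 2 - (y₀ * Real.exp (x 2)) ^ 2 ≠ 0 := by
    have h1 := hx.1
    have h2 := mul_pos h0 (Real.exp_pos (x 2))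
    nlinarith
  have hD : ContDiffAt ℝ ∞ (fun x : Fin 4 → ℝ => zetaDisc y₀ (x 2) (x 3)) x :=
    ContDiffAt.sqrt (by fun_prop) hpos.ne'
  have hz1 : ContDiffAt ℝ ∞ (fun x : Fin 4 → ℝ => zetaOne y₀ (x 2) (x 3)) x :=
    ContDiffAt.div (by fun_prop) (by fun_prop) hden
  have hz2 : ContDiffAt ℝ ∞ (fun x : Fin 4 → ℝ => zetaTwo y₀ (x 2) (x 3)) x :=
    ContDiffAt.div (by fun_prop) (by fun_prop) hden
  refine contDiffAt_pi.2 fun i => ?_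
  fin_cases i <;> simp only [reducedField, Fin.isValue, Fin.mk_zero, Fin.mk_one, Fin.reduceFinMk,
    Matrix.cons_val]
  · exact ContDiffAt.div (by fun_prop) hD hD0
  · exact (ContDiffAt.div (by fun_prop) hD hD0).neg
  · have h1 := ContDiffAt.div (f := fun x : Fin 4 → ℝ => x 0 ^ 2 * (zetaOne y₀ (x 2) (x 3) ^ 2 + 1))
      (by fun_prop) hD hD0
    have h2 := ContDiffAt.div (f := fun x : Fin 4 → ℝ => x 1 ^ 2 * (zetaTwo y₀ (x 2) (x 3) ^ 2 + 1))
      (by fun_prop) hD hD0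
    fun_prop
  · have h1 := ContDiffAt.div (f := fun x : Fin 4 → ℝ => x 0 ^ 2 * zetaOne y₀ (x 2) (x 3) ^ 2)
      (by fun_prop) hD hD0
    have h2 := ContDiffAt.div (f := fun x : Fin 4 → ℝ => x 1 ^ 2 * zetaTwo y₀ (x 2) (x 3) ^ 2)
      (by fun_prop) hD hD0
    fun_prop

/-- The positive eigenvalue of the linearisation at the steady state. -/
noncomputable def rate (y₀ : ℝ) : ℝ := √(1 - y₀ ^ 2) / y₀

/-- The density `Q₂` at the steady state. -/
noncomputable def steadyQ (y₀ θ : ℝ) : ℝ := 2 * √y₀ / ((3 : ℝ) ^ (1 / 4 : ℝ) * √θ)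

theorem three_rpow_quarter_sq : ((3 : ℝ) ^ (1 / 4 : ℝ)) ^ 2 = √3 := by
  rw [← Real.rpow_natCast, ← Real.rpow_mul (by norm_num), Real.sqrt_eq_rpow]
  norm_num

theorem sqrt_three_mul_steadyQ_sq (h0 : 0 < y₀) (hθ : 0 < θ) :
    √3 * θ * steadyQ y₀ θ ^ 2 = 4 * y₀ := by
  rw [steadyQ, div_pow, mul_pow, mul_pow, three_rpow_quarter_sq, Real.sq_sqrt h0.le,
    Real.sq_sqrt hθ.le]
  field_simp
  norm_num

theorem steadyQ_pos (h0 : 0 < y₀) (hθ : 0 < θ) : 0 < steadyQ y₀ θ := by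
  unfold steadyQ; positivity

theorem one_sub_sq_pos (h0 : 0 < y₀) (h1 : y₀ < 1 / 2) : 0 < 1 - y₀ ^ 2 := by nlinarith

theorem rate_pos (h0 : 0 < y₀) (h1 : y₀ < 1 / 2) : 0 < rate y₀ :=
  div_pos (Real.sqrt_pos.2 (one_sub_sq_pos h0 h1)) h0

theorem rate_sq (h0 : 0 < y₀) (h1 : y₀ < 1 / 2) : rate y₀ ^ 2 = (1 - y₀ ^ 2) / y₀ ^ 2 := by
  rw [rate, div_pow, Real.sq_sqrt (one_sub_sq_pos h0 h1).le]

theorem one_lt_rate (h0 : 0 < y₀) (h1 : y₀ < 1 / 2) : 1 < rate y₀ := by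
  refine (one_lt_sq_iff₀ (rate_pos h0 h1).le).1 ?_
  rw [rate_sq h0 h1, one_lt_div (by positivity)]
  nlinarith

theorem rate_eq_two_iff (h0 : 0 < y₀) (h1 : y₀ < 1 / 2) : rate y₀ = 2 ↔ y₀ = 1 / √5 := by
  have h5 : √5 ^ 2 = 5 := Real.sq_sqrt (by norm_num)
  have hy : y₀ = 1 / √5 ↔ 5 * y₀ ^ 2 = 1 := by
    rw [← sq_eq_sq₀ h0.le (by positivity), div_pow, h5, eq_div_iff (by norm_num)]
    constructor <;> intro h <;> linarith
  rw [hy, ← sq_eq_sq₀ (rate_pos h0 h1).le (by norm_num), rate_sq h0 h1, div_eq_iff (by positivity)]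
  constructor <;> intro h <;> linarith

theorem eigvec_eq (h0 : 0 < y₀) (h1 : y₀ < 1 / 2) (hθ : 0 < θ) : eigvec y₀ θ =
    ![![1, 0, 0, 0], ![0, -(rate y₀ ^ 2 * steadyQ y₀ θ / 6), -(2 / 3), 1],
      ![0, -(rate y₀ * steadyQ y₀ θ / 3), -(rate y₀ / 3), 1],
      ![0, rate y₀ * steadyQ y₀ θ / 3, rate y₀ / 3, 1]] := by
  have h54 : (3 : ℝ) ^ (5 / 4 : ℝ) = 3 * (3 : ℝ) ^ (1 / 4 : ℝ) := by
    rw [show (5 / 4 : ℝ) = 1 + 1 / 4 by norm_num, Real.rpow_add (by norm_num), Real.rpow_one]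
  have hy : y₀ ^ (3 / 2 : ℝ) = y₀ * √y₀ := by
    rw [show (3 / 2 : ℝ) = 1 + 1 / 2 by norm_num, Real.rpow_add h0, Real.rpow_one,
      Real.sqrt_eq_rpow]
  have hs : √y₀ ^ 2 = y₀ := Real.sq_sqrt h0.le
  have hs0 : 0 < √y₀ := Real.sqrt_pos.2 h0
  have ht0 : 0 < √θ := Real.sqrt_pos.2 hθ
  have e1 : (1 - y₀ ^ 2) / ((3 : ℝ) ^ (5 / 4 : ℝ) * y₀ ^ (3 / 2 : ℝ) * √θ) =
      rate y₀ ^ 2 * steadyQ y₀ θ / 6 := by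
    rw [rate_sq h0 h1, steadyQ, h54, hy]
    field_simp
    rw [hs]; ring
  have e2 : 2 * √(1 - y₀ ^ 2) / ((3 : ℝ) ^ (5 / 4 : ℝ) * √y₀ * √θ) =
      rate y₀ * steadyQ y₀ θ / 3 := by
    rw [rate, steadyQ, h54]
    field_simp
    rw [hs]; ring
  have e3 : √(1 - y₀ ^ 2) / (3 * y₀) = rate y₀ / 3 := by rw [rate]; field_simp
  rw [eigvec, e1, e2, e3]

theorem resonantVec_eq (h0 : 0 < y₀) (hθ : 0 < θ) :
    resonantVec y₀ θ = ![0, -(rate y₀ * steadyQ y₀ θ / 2), 1, 0] := by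
  have hs : √y₀ ^ 2 = y₀ := Real.sq_sqrt h0.le
  have hs0 : 0 < √y₀ := Real.sqrt_pos.2 h0
  have ht0 : 0 < √θ := Real.sqrt_pos.2 hθ
  have : √(1 - y₀ ^ 2) / ((3 : ℝ) ^ (1 / 4 : ℝ) * √y₀ * √θ) = rate y₀ * steadyQ y₀ θ / 2 := by
    rw [rate, steadyQ]
    field_simp
    rw [hs]; ring
  rw [resonantVec, this]

theorem steadyState_eq (y₀ θ : ℝ) :
    steadyState y₀ θ = ![0, steadyQ y₀ θ, Real.log 3 / 2, Real.log √(1 - y₀ ^ 2)] := rfl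

theorem exp_log_three_div_two : Real.exp (Real.log 3 / 2) = √3 := by
  rw [← Real.log_sqrt (by norm_num), Real.exp_log (by positivity)]

theorem exp_two_mul_log_three_div_two : Real.exp (2 * (Real.log 3 / 2)) = 3 := by
  rw [mul_div_cancel₀ _ (by norm_num : (2 : ℝ) ≠ 0), Real.exp_log (by norm_num)]

theorem steadyState_mem_phaseDomain (h0 : 0 < y₀) (h1 : y₀ < 1 / 2) (θ : ℝ) :
    steadyState y₀ θ ∈ phaseDomain y₀ := by
  have h3 : √3 ^ 2 = 3 := Real.sq_sqrt (by norm_num)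
  have hk := Real.sq_sqrt (one_sub_sq_pos h0 h1).le
  have hk0 := Real.sqrt_pos.2 (one_sub_sq_pos h0 h1)
  simp only [phaseDomain, mem_ofPred_eq, steadyState_eq, Matrix.cons_val, exp_log_three_div_two,
    Real.exp_log hk0]
  constructor
  · refine lt_of_pow_lt_pow_left₀ 2 hk0.le ?_
    rw [mul_pow, h3, hk]; nlinarith
  · rw [mul_pow, h3, hk]; nlinarith

theorem zetaDisc_steady (h0 : 0 < y₀) (h1 : y₀ < 1 / 2) :
    zetaDisc y₀ (Real.log 3 / 2) (Real.log √(1 - y₀ ^ 2)) = √3 * y₀ := by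
  have hk := Real.sq_sqrt (one_sub_sq_pos h0 h1).le
  have hk0 := Real.sqrt_pos.2 (one_sub_sq_pos h0 h1)
  have h : 1 - y₀ ^ 2 - √(1 - y₀ ^ 2) ^ 2 + (y₀ * √3) ^ 2 = (√3 * y₀) ^ 2 := by rw [hk]; ring
  rw [zetaDisc, exp_log_three_div_two, Real.exp_log hk0, h, Real.sqrt_sq (by positivity)]

theorem zetaTwo_steady (h0 : 0 < y₀) (h1 : y₀ < 1 / 2) :
    zetaTwo y₀ (Real.log 3 / 2) (Real.log √(1 - y₀ ^ 2)) = 0 := by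
  have hk0 := Real.sqrt_pos.2 (one_sub_sq_pos h0 h1)
  rw [zetaTwo, zetaDisc_steady h0 h1, exp_log_three_div_two, Real.exp_log hk0]
  ring_nf

theorem zetaOne_steady (h0 : 0 < y₀) (h1 : y₀ < 1 / 2) :
    zetaOne y₀ (Real.log 3 / 2) (Real.log √(1 - y₀ ^ 2)) =
      -(2 * √3 * y₀ * √(1 - y₀ ^ 2)) / (1 - 4 * y₀ ^ 2) := by
  have h3 : √3 ^ 2 = 3 := Real.sq_sqrt (by norm_num)
  have hk := Real.sq_sqrt (one_sub_sq_pos h0 h1).le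
  have hk0 := Real.sqrt_pos.2 (one_sub_sq_pos h0 h1)
  rw [zetaOne, zetaDisc_steady h0 h1, exp_log_three_div_two, Real.exp_log hk0, hk, mul_pow, h3]
  congr 1 <;> ring

theorem reducedField_steadyState (h0 : 0 < y₀) (h1 : y₀ < 1 / 2) (hθ : 0 < θ) :
    reducedField y₀ θ (steadyState y₀ θ) = 0 := by
  have hQ := sqrt_three_mul_steadyQ_sq h0 hθ
  have hs : 0 < √3 := by positivity
  have h3 : √3 ^ 2 = 3 := Real.sq_sqrt (by norm_num)
  ext i
  fin_cases i <;> simp [reducedField, steadyState_eq, zetaTwo_steady h0 h1, zetaDisc_steady h0 h1,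
    exp_two_mul_log_three_div_two]
  field_simp
  nlinarith

/-- The linearisation of the reduced system at the steady state. -/
theorem fderiv_reducedField (h0 : 0 < y₀) (h1 : y₀ < 1 / 2) (hθ : 0 < θ) (v : Fin 4 → ℝ) :
    fderiv ℝ (reducedField y₀ θ) (steadyState y₀ θ) v =
      ![eigval y₀ 0 * v 0, rate y₀ ^ 2 * steadyQ y₀ θ / 3 * v 3,
        2 / steadyQ y₀ θ * v 1 - 2 * v 2 + rate y₀ ^ 2 / 3 * v 3, 3 * v 2] := by
  have hdiff : DifferentiableAt ℝ (reducedField y₀ θ) (steadyState y₀ θ) :=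
    ((contDiffOn_reducedField h0 θ).contDiffAt ((isOpen_phaseDomain y₀).mem_nhds
      (steadyState_mem_phaseDomain h0 h1 θ))).differentiableAt (by simp)
  have hline : HasDerivAt (fun t : ℝ => steadyState y₀ θ + t • v) v 0 := by
    simpa using ((hasDerivAt_id (0 : ℝ)).smul_const v).const_add (steadyState y₀ θ)
  have hf : HasFDerivAt (reducedField y₀ θ) (fderiv ℝ (reducedField y₀ θ) (steadyState y₀ θ))
      (steadyState y₀ θ + (0 : ℝ) • v) := by
    rw [zero_smul, add_zero]; exact hdiff.hasFDerivAt
  have hcurve := hasDerivAt_pi.1 (hf.comp_hasDerivAt (0 : ℝ) hline)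
  -- the ingredients of the field along the line `t ↦ steadyState y₀ θ + t • v`
  have h3 : √3 ^ 2 = 3 := Real.sq_sqrt (by norm_num)
  have hk := Real.sq_sqrt (one_sub_sq_pos h0 h1).le
  have hk0 := Real.sqrt_pos.2 (one_sub_sq_pos h0 h1)
  have hs0 : 0 < √3 := by positivity
  set κ := √(1 - y₀ ^ 2) with hκ
  set s := √3 with hs
  set Q := steadyQ y₀ θ with hQdef
  have hQ0 : 0 < Q := steadyQ_pos h0 hθ
  have hQ : s * θ * Q ^ 2 = 4 * y₀ := sqrt_three_mul_steadyQ_sq h0 hθ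
  have hden : κ ^ 2 - (y₀ * s) ^ 2 = 1 - 4 * y₀ ^ 2 := by rw [mul_pow, h3, hk]; ring
  have hden0 : 1 - 4 * y₀ ^ 2 ≠ 0 := by nlinarith
  obtain ⟨m, hm⟩ : ∃ m, m = 1 - 4 * y₀ ^ 2 := ⟨_, rfl⟩
  have hm0 : m ≠ 0 := hm ▸ hden0
  have hden' : κ ^ 2 - (y₀ * s) ^ 2 = m := hm ▸ hden
  let Λ : ℝ → ℝ := fun t => Real.log 3 / 2 + t * v 2
  let u : ℝ → ℝ := fun t => Real.log κ + t * v 3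
  have hΛ : HasDerivAt Λ (v 2) 0 := by
    exact (((hasDerivAt_id' (0 : ℝ)).mul_const (v 2)).const_add _).congr_deriv (one_mul _)
  have hu : HasDerivAt u (v 3) 0 := by
    exact (((hasDerivAt_id' (0 : ℝ)).mul_const (v 3)).const_add _).congr_deriv (one_mul _)
  have hΛ0 : Λ 0 = Real.log 3 / 2 := by simp [Λ]
  have hu0 : u 0 = Real.log κ := by simp [u]
  have hb : HasDerivAt (fun t => Real.exp (Λ t)) (s * v 2) 0 :=
    hΛ.exp.congr_deriv (by rw [hΛ0, exp_log_three_div_two])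
  have ha : HasDerivAt (fun t => Real.exp (u t)) (κ * v 3) 0 :=
    hu.exp.congr_deriv (by rw [hu0, Real.exp_log hk0])
  have hb2 : HasDerivAt (fun t => Real.exp (2 * Λ t)) (6 * v 2) 0 :=
    (hΛ.const_mul 2).exp.congr_deriv (by rw [hΛ0, exp_two_mul_log_three_div_two]; ring)
  have hb0 : Real.exp (Λ 0) = s := by rw [hΛ0, exp_log_three_div_two]
  have ha0 : Real.exp (u 0) = κ := by rw [hu0, Real.exp_log hk0]
  have hb20 : Real.exp (2 * Λ 0) = 3 := by rw [hΛ0, exp_two_mul_log_three_div_two]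
  let D : ℝ → ℝ := fun t => zetaDisc y₀ (Λ t) (u t)
  have hD0 : D 0 = s * y₀ := by
    simp only [D, hΛ0, hu0]; exact zetaDisc_steady h0 h1
  have hsy : 0 < s * y₀ := by positivity
  have hD : HasDerivAt D (s * y₀ * v 2 - κ ^ 2 / (s * y₀) * v 3) 0 := by
    have e := (((ha.fun_pow 2).const_sub (1 - y₀ ^ 2)).fun_add
      ((hb.const_mul y₀).fun_pow 2))
    have e0 : √(1 - y₀ ^ 2 - Real.exp (u 0) ^ 2 + (y₀ * Real.exp (Λ 0)) ^ 2) = s * y₀ := hD0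
    have ene : 1 - y₀ ^ 2 - Real.exp (u 0) ^ 2 + (y₀ * Real.exp (Λ 0)) ^ 2 ≠ 0 := by
      rw [ha0, hb0, hk, mul_pow, h3]
      nlinarith
    refine (e.sqrt ene).congr_deriv ?_
    rw [e0, ha0, hb0]
    field_simp
    ring
  have hdenD : HasDerivAt (fun t => Real.exp (u t) ^ 2 - (y₀ * Real.exp (Λ t)) ^ 2)
      (2 * κ ^ 2 * v 3 - 2 * (y₀ * s) ^ 2 * v 2) 0 := by
    refine ((ha.fun_pow 2).fun_sub ((hb.const_mul y₀).fun_pow 2)).congr_deriv ?_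
    rw [ha0, hb0]
    ring
  have hdenne : Real.exp (u 0) ^ 2 - (y₀ * Real.exp (Λ 0)) ^ 2 ≠ 0 := by
    rw [ha0, hb0, hden]; exact hden0
  obtain ⟨d, hz1⟩ : ∃ d, HasDerivAt (fun t => zetaOne y₀ (Λ t) (u t)) d 0 :=
    ⟨_, ((((hb.const_mul y₀).mul_const κ).fun_neg).fun_sub (ha.fun_mul hD)).fun_div hdenD hdenne⟩
  have hz10 : zetaOne y₀ (Λ 0) (u 0) = -(2 * s * y₀ * κ) / (1 - 4 * y₀ ^ 2) := by
    rw [hΛ0, hu0]; exact zetaOne_steady h0 h1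
  have hz20 : zetaTwo y₀ (Λ 0) (u 0) = 0 := by
    rw [hΛ0, hu0]; exact zetaTwo_steady h0 h1
  have hz2 : HasDerivAt (fun t => zetaTwo y₀ (Λ t) (u t)) (-(κ / (s * y₀)) * v 3) 0 := by
    refine (((((hb.const_mul y₀).mul_const κ).fun_neg).fun_add
      (ha.fun_mul hD)).fun_div hdenD hdenne).congr_deriv ?_
    rw [ha0, hb0, hD0, hden, ← hm]
    field_simp
    linear_combination (-v 3 * m) * hden'
  have hQ1 : HasDerivAt (fun t : ℝ => t * v 0) (v 0) 0 := by
    simpa using (hasDerivAt_id (0 : ℝ)).mul_const (v 0)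
  have hQ2 : HasDerivAt (fun t : ℝ => Q + t * v 1) (v 1) 0 := by
    simpa using ((hasDerivAt_id (0 : ℝ)).mul_const (v 1)).const_add Q
  have hDne : D 0 ≠ 0 := by rw [hD0]; exact hsy.ne'
  have hr : rate y₀ = κ / y₀ := rfl
  have hst : steadyState y₀ θ = ![0, Q, Real.log 3 / 2, Real.log κ] := rfl
  have huniq : ∀ {i : Fin 4} {F : ℝ → ℝ} {F' : ℝ}, HasDerivAt F F' 0 →
      (∀ t, reducedField y₀ θ (steadyState y₀ θ + t • v) i = F t) →
      fderiv ℝ (reducedField y₀ θ) (steadyState y₀ θ) v i = F' := fun {i F F'} hF h =>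
    (hcurve i).unique (hF.congr_of_eventuallyEq (Eventually.of_forall h))
  ext i
  fin_cases i
  · refine (huniq (((ha.fun_mul hQ1).fun_mul hz1).fun_div hD hDne) fun t => by
      simp [reducedField, hst, Λ, u, D]).trans ?_
    simp only [Fin.isValue, Fin.zero_eta, Matrix.cons_val, eigval]
    rw [hz10, hD0, ha0, ← hk, ← hm]
    field_simp
    ring
  · refine (huniq (((ha.fun_mul hQ2).fun_mul hz2).fun_div hD hDne).fun_neg fun t => by
      simp [reducedField, hst, Λ, u, D]).trans ?_
    simp only [Fin.isValue, Fin.mk_one, Matrix.cons_val]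
    rw [hz20, hD0, ha0, hr]
    field_simp
    linear_combination (-(κ * v 3 * Q * s * y₀)) * h3
  · refine (huniq (((hb2.fun_mul (((((hQ1.fun_pow 2).fun_mul ((hz1.fun_pow 2).add_const 1)).fun_div
      hD hDne).fun_add (((hQ2.fun_pow 2).fun_mul ((hz2.fun_pow 2).add_const 1)).fun_div
      hD hDne)).const_mul (θ / 2) |>.sub_const 1)).const_add 1).div_const 2) fun t => by
      simp [reducedField, hst, Λ, u, D]).trans ?_
    simp only [Fin.isValue, Fin.reduceFinMk, Matrix.cons_val]
    rw [hz20, hD0, hb20, hr]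
    have hθQ : θ = 4 * y₀ / (s * Q ^ 2) := by
      rw [eq_div_iff (by positivity)]; linarith
    rw [hθQ]
    field_simp
    have h4 : s ^ 4 = 9 := by rw [show s ^ 4 = (s ^ 2) ^ 2 by ring, h3]; norm_num
    norm_num
    linear_combination (36 * v 2 * y₀ ^ 2 * Q ^ 2 + 72 * y₀ ^ 2 * v 1 * Q) * h3 +
      (-36 * v 2 * y₀ ^ 2 * Q ^ 2 - 24 * Q * y₀ ^ 2 * (v 1 - v 2 * Q) -
        4 * Q ^ 2 * κ ^ 2 * v 3) * h4
  · refine (huniq ((hb2.fun_mul (((((hQ1.fun_pow 2).fun_mul (hz1.fun_pow 2)).fun_div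
      hD hDne).fun_add (((hQ2.fun_pow 2).fun_mul (hz2.fun_pow 2)).fun_div
      hD hDne)).const_mul (θ / 2) |>.add_const 1)).sub_const 3 |>.div_const 2) fun t => by
      simp [reducedField, hst, Λ, u, D]).trans ?_
    simp only [Fin.isValue, Fin.reduceFinMk, Matrix.cons_val]
    rw [hz20, hb20]
    ring

end Reduced

/-! ### Linear algebra at the steady state and the stable manifold of the reduced system -/

section Main

variable {y₀ θ : ℝ}

theorem eigval_zero_le (h0 : 0 < y₀) (h1 : y₀ < 1 / 2) : eigval y₀ 0 ≤ -2 := by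
  change -(2 * (1 - y₀ ^ 2) / (1 - 4 * y₀ ^ 2)) ≤ -2
  have : 0 < 1 - 4 * y₀ ^ 2 := by nlinarith
  rw [neg_le_neg_iff, le_div_iff₀ this]
  nlinarith

theorem eigval_eq (y₀ : ℝ) : eigval y₀ = ![eigval y₀ 0, -2, -rate y₀, rate y₀] := by
  ext i
  fin_cases i <;> rfl

/-- The basis in which the linearisation is nearly diagonal: the eigenvectors for the first, second
and fourth eigenvalue, and a quarter of `resonantVec`, which lies in the span of the second and third
eigenvectors when these are different. It works with and without resonance. -/
noncomputable def nearEigenbasis (y₀ θ : ℝ) : (Fin 4 → ℝ) →ₗ[ℝ] (Fin 4 → ℝ) :=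
  Fintype.linearCombination ℝ
    ![eigvec y₀ θ 0, eigvec y₀ θ 1, (1 / 4 : ℝ) • resonantVec y₀ θ, eigvec y₀ θ 3]

theorem nearEigenbasis_apply (y₀ θ : ℝ) (z : Fin 4 → ℝ) : nearEigenbasis y₀ θ z =
    z 0 • eigvec y₀ θ 0 + z 1 • eigvec y₀ θ 1 + (z 2 / 4) • resonantVec y₀ θ +
      z 3 • eigvec y₀ θ 3 := by
  simp [nearEigenbasis, Fintype.linearCombination_apply, Fin.sum_univ_four, smul_smul]
  ring_nf

theorem nearEigenbasis_apply' (h0 : 0 < y₀) (h1 : y₀ < 1 / 2) (hθ : 0 < θ) (z : Fin 4 → ℝ) :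
    nearEigenbasis y₀ θ z = ![z 0, steadyQ y₀ θ * (-(rate y₀ ^ 2 / 6 * z 1) - rate y₀ / 8 * z 2 +
      rate y₀ / 3 * z 3), -(2 / 3 * z 1) + z 2 / 4 + rate y₀ / 3 * z 3, z 1 + z 3] := by
  rw [nearEigenbasis_apply, eigvec_eq h0 h1 hθ, resonantVec_eq h0 hθ]
  ext i
  fin_cases i <;> simp <;> ring

theorem nearEigenbasis_injective (h0 : 0 < y₀) (h1 : y₀ < 1 / 2) (hθ : 0 < θ) :
    Function.Injective (nearEigenbasis y₀ θ) := by
  rw [injective_iff_map_eq_zero]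
  intro z hz
  rw [nearEigenbasis_apply' h0 h1 hθ] at hz
  have e0 : z 0 = 0 := congrFun hz 0
  have e1 : steadyQ y₀ θ * (-(rate y₀ ^ 2 / 6 * z 1) - rate y₀ / 8 * z 2 +
      rate y₀ / 3 * z 3) = 0 := congrFun hz 1
  have e2 : -(2 / 3 * z 1) + z 2 / 4 + rate y₀ / 3 * z 3 = 0 := congrFun hz 2
  have e3 : z 1 + z 3 = 0 := congrFun hz 3
  have hr := rate_pos h0 h1
  have e1' := (mul_eq_zero.1 e1).resolve_left (steadyQ_pos h0 hθ).ne'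
  have h3 : z 3 = -z 1 := by linarith
  have h2 : z 2 = 4 * (2 / 3 * z 1 + rate y₀ / 3 * z 1) := by rw [h3] at e2; linarith
  have hz1 : z 1 = 0 := by
    rw [h3, h2] at e1'
    have : rate y₀ * (rate y₀ + 2) * z 1 = 0 := by linarith
    exact (mul_eq_zero.1 this).resolve_left (by positivity)
  ext i
  fin_cases i
  · exact e0
  · exact hz1
  · change z 2 = 0; rw [h2, hz1]; ring
  · change z 3 = 0; rw [h3, hz1]; ring

/-- `nearEigenbasis` as a linear equivalence. -/
noncomputable def nearEigenbasisEquiv (h0 : 0 < y₀) (h1 : y₀ < 1 / 2) (hθ : 0 < θ) :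
    (Fin 4 → ℝ) ≃L[ℝ] (Fin 4 → ℝ) :=
  (LinearEquiv.ofInjectiveEndo _ (nearEigenbasis_injective h0 h1 hθ)).toContinuousLinearEquiv

theorem nearEigenbasisEquiv_apply (h0 : 0 < y₀) (h1 : y₀ < 1 / 2) (hθ : 0 < θ) (z : Fin 4 → ℝ) :
    nearEigenbasisEquiv h0 h1 hθ z = nearEigenbasis y₀ θ z := rfl

/-- The off-diagonal part of the linearisation in the basis `nearEigenbasis`. -/
noncomputable def offDiagonal : (Fin 4 → ℝ) →L[ℝ] (Fin 4 → ℝ) :=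
  (3 / 4 : ℝ) • (ContinuousLinearMap.single ℝ (fun _ : Fin 4 => ℝ) 1).comp
    (ContinuousLinearMap.proj (R := ℝ) (φ := fun _ : Fin 4 => ℝ) 2)

theorem offDiagonal_apply (z : Fin 4 → ℝ) : offDiagonal z = ![0, 3 / 4 * z 2, 0, 0] := by
  ext i
  fin_cases i <;> simp [offDiagonal]

theorem norm_offDiagonal_lt : ‖offDiagonal‖ < 1 := by
  refine (ContinuousLinearMap.opNorm_le_bound _ (M := 3 / 4) (by norm_num) fun z => ?_).trans_lt
    (by norm_num)
  rw [offDiagonal_apply, pi_norm_le_iff_of_nonneg (by positivity)]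
  intro i
  have := norm_le_pi_norm z 2
  fin_cases i <;> simp
  all_goals nlinarith [this, norm_nonneg z, Real.norm_eq_abs (z 2)]

theorem fderiv_nearEigenbasis (h0 : 0 < y₀) (h1 : y₀ < 1 / 2) (hθ : 0 < θ) (z : Fin 4 → ℝ) :
    fderiv ℝ (reducedField y₀ θ) (steadyState y₀ θ) (nearEigenbasisEquiv h0 h1 hθ z) =
      nearEigenbasisEquiv h0 h1 hθ (eigval y₀ * z + offDiagonal z) := by
  have hQ := (steadyQ_pos h0 hθ).ne'
  rw [fderiv_reducedField h0 h1 hθ, nearEigenbasisEquiv_apply, nearEigenbasisEquiv_apply,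
    nearEigenbasis_apply' h0 h1 hθ, nearEigenbasis_apply' h0 h1 hθ, offDiagonal_apply,
    eigval_eq y₀]
  ext i
  fin_cases i <;> simp
  · field_simp; ring
  · field_simp; ring
  · ring

theorem fderiv_eigvec (h0 : 0 < y₀) (h1 : y₀ < 1 / 2) (hθ : 0 < θ) (i : Fin 4) :
    fderiv ℝ (reducedField y₀ θ) (steadyState y₀ θ) (eigvec y₀ θ i) =
      eigval y₀ i • eigvec y₀ θ i := by
  have hQ := (steadyQ_pos h0 hθ).ne'
  rw [fderiv_reducedField h0 h1 hθ, eigvec_eq h0 h1 hθ, eigval_eq y₀]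
  ext j
  fin_cases i <;> fin_cases j <;> simp
  all_goals field_simp
  all_goals ring

/-- In the basis `nearEigenbasis` the linearisation is triangular. -/
theorem charpoly_fderiv_reducedField (h0 : 0 < y₀) (h1 : y₀ < 1 / 2) (hθ : 0 < θ) :
    (fderiv ℝ (reducedField y₀ θ) (steadyState y₀ θ)).toLinearMap.charpoly =
      ∏ i : Fin 4, (Polynomial.X - Polynomial.C (eigval y₀ i)) := by
  let M : Matrix (Fin 4) (Fin 4) ℝ := Matrix.diagonal (eigval y₀) + Matrix.single 1 2 (3 / 4)
  have hM : ∀ z, Matrix.toLin' M z = eigval y₀ * z + offDiagonal z := fun z => by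
    rw [Matrix.toLin'_apply, Matrix.add_mulVec, offDiagonal_apply]
    congr 1
    · ext i; rw [Matrix.mulVec_diagonal]; rfl
    · ext i
      fin_cases i <;> simp [Matrix.single_mulVec]
  have hconj : (fderiv ℝ (reducedField y₀ θ) (steadyState y₀ θ)).toLinearMap =
      (nearEigenbasisEquiv h0 h1 hθ).toLinearEquiv.conj (Matrix.toLin' M) := by
    refine LinearMap.ext fun x => ?_
    obtain ⟨z, rfl⟩ := (nearEigenbasisEquiv h0 h1 hθ).surjective x
    refine (fderiv_nearEigenbasis h0 h1 hθ z).trans ?_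
    rw [LinearEquiv.conj_apply_apply, ← hM]
    exact congrArg _ (congrArg _ ((nearEigenbasisEquiv h0 h1 hθ).symm_apply_apply z).symm)
  have hup : M.BlockTriangular id := by
    intro i j hij
    fin_cases i <;> fin_cases j <;> simp_all [M, Matrix.single]
  rw [hconj, LinearEquiv.charpoly_conj, Matrix.charpoly_toLin', Matrix.charpoly_of_isUpperTriangular _ hup]
  refine Finset.prod_congr rfl fun i _ => ?_
  have : M i i = eigval y₀ i := by
    fin_cases i <;> simp [M, Matrix.single]
  rw [this]

theorem image_coordSubspace (h0 : 0 < y₀) (h1 : y₀ < 1 / 2) (hθ : 0 < θ) :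
    nearEigenbasisEquiv h0 h1 hθ '' coordSubspace 4 3 =
      (Submodule.span ℝ {eigvec y₀ θ 0, eigvec y₀ θ 1, resonantVec y₀ θ} :
        Submodule ℝ (Fin 4 → ℝ)) := by
  ext x
  rw [SetLike.mem_coe, Submodule.mem_span_triple]
  constructor
  · rintro ⟨z, hz, rfl⟩
    refine ⟨z 0, z 1, z 2 / 4, ?_⟩
    rw [nearEigenbasisEquiv_apply, nearEigenbasis_apply, hz 3 le_rfl, zero_smul, add_zero]
  · rintro ⟨a, b, c, rfl⟩
    refine ⟨![a, b, 4 * c, 0], fun i hi => ?_, ?_⟩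
    · fin_cases i <;> simp_all
    · rw [nearEigenbasisEquiv_apply, nearEigenbasis_apply]
      simp

/-- Without resonance, `resonantVec` may be replaced by the third eigenvector. -/
theorem span_eigvec_eq (h0 : 0 < y₀) (h1 : y₀ < 1 / 2) (hθ : 0 < θ) (hne : y₀ ≠ 1 / √5) :
    Submodule.span ℝ {eigvec y₀ θ 0, eigvec y₀ θ 1, resonantVec y₀ θ} =
      Submodule.span ℝ {eigvec y₀ θ 0, eigvec y₀ θ 1, eigvec y₀ θ 2} := by
  have hr : 2 - rate y₀ ≠ 0 := fun h => hne ((rate_eq_two_iff h0 h1).1 (by linarith))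
  have key : eigvec y₀ θ 2 = eigvec y₀ θ 1 + ((2 - rate y₀) / 3) • resonantVec y₀ θ := by
    rw [eigvec_eq h0 h1 hθ, resonantVec_eq h0 hθ]
    ext i
    fin_cases i <;> simp <;> ring
  ext x
  rw [Submodule.mem_span_triple, Submodule.mem_span_triple]
  constructor
  · rintro ⟨a, b, c, rfl⟩
    refine ⟨a, b - 3 * c / (2 - rate y₀), 3 * c / (2 - rate y₀), ?_⟩
    rw [key, smul_add, smul_smul, sub_smul,
      show 3 * c / (2 - rate y₀) * ((2 - rate y₀) / 3) = c by field_simp]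
    abel
  · rintro ⟨a, b, c, rfl⟩
    refine ⟨a, b + c, c * ((2 - rate y₀) / 3), ?_⟩
    rw [key, smul_add, smul_smul, add_smul]
    abel

theorem isForwardSolution_iff (h0 : 0 < y₀) (h1 : y₀ < 1 / 2) {γ : ℝ → Fin 4 → ℝ} :
    IsForwardSolution y₀ θ γ ↔ IsForwardSolutionIn (reducedField y₀ θ) (phaseDomain y₀) γ := by
  have h1' : y₀ < 1 := by linarith
  refine forall₂_congr fun s _ => ⟨?_, fun ⟨h, h'⟩ => ⟨_, h', (reducedSystem_iff h0 h1' _ _).2 ⟨h, rfl⟩⟩⟩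
  rintro ⟨v, hv, hs⟩
  obtain ⟨h, rfl⟩ := (reducedSystem_iff h0 h1' _ _).1 hs
  exact ⟨h, hv⟩

theorem stableSetFrom_eq (h0 : 0 < y₀) (h1 : y₀ < 1 / 2) (U : Set (Fin 4 → ℝ)) (T : ℝ) :
    stableSetFrom y₀ θ U T =
      stableSetIn (reducedField y₀ θ) (phaseDomain y₀) (steadyState y₀ θ) U T := by
  simp only [stableSetFrom, stableSetIn, isForwardSolution_iff h0 h1]

theorem isHyperbolicSaddle_steadyState (h0 : 0 < y₀) (h1 : y₀ < 1 / 2) (hθ : 0 < θ) :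
    IsHyperbolicSaddle (reducedField y₀ θ) (steadyState y₀ θ) := by
  have hroot : ∀ z : ℂ, Polynomial.aeval z
      (fderiv ℝ (reducedField y₀ θ) (steadyState y₀ θ)).toLinearMap.charpoly = 0 ↔
      ∃ i, z = eigval y₀ i := fun z => by
    rw [charpoly_fderiv_reducedField h0 h1 hθ, map_prod, Finset.prod_eq_zero_iff]
    simp [sub_eq_zero]
  have hr := rate_pos h0 h1
  have he := eigval_zero_le h0 h1
  refine ⟨reducedField_steadyState h0 h1 hθ, ((contDiffOn_reducedField h0 θ).contDiffAt
    ((isOpen_phaseDomain y₀).mem_nhds (steadyState_mem_phaseDomain h0 h1 θ))).differentiableAt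
    (by simp), fun z hz => ?_, ⟨eigval y₀ 1, (hroot _).2 ⟨1, rfl⟩, ?_⟩,
    ⟨eigval y₀ 3, (hroot _).2 ⟨3, rfl⟩, ?_⟩⟩
  · obtain ⟨i, rfl⟩ := (hroot z).1 hz
    rw [Complex.ofReal_re, eigval_eq]
    fin_cases i <;> simp
    · linarith
    · exact hr.ne'
    · exact hr.ne'
  · rw [Complex.ofReal_re, eigval_eq]; simp
  · rw [Complex.ofReal_re, eigval_eq]; simpa using hr

end Main

theorem mainTheorem4 (y₀ θ : ℝ) (hy₀ : 0 < y₀) (hy₀' : y₀ < 1 / 2) (hθ : 0 < θ) :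
    -- `P₁` is a steady state of the reduced system, and a hyperbolic saddle
    ReducedSystem y₀ θ (steadyState y₀ θ) 0 ∧
    IsHyperbolicSaddle (reducedField y₀ θ) (steadyState y₀ θ) ∧
    -- the eigenvalues (with multiplicity), their signs, and the eigenvectors
    (fderiv ℝ (reducedField y₀ θ) (steadyState y₀ θ)).toLinearMap.charpoly =
      ∏ i : Fin 4, (Polynomial.X - Polynomial.C (eigval y₀ i)) ∧
    eigval y₀ 0 < 0 ∧ eigval y₀ 1 < 0 ∧ eigval y₀ 2 < 0 ∧ 0 < eigval y₀ 3 ∧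
    (∀ i : Fin 4, fderiv ℝ (reducedField y₀ θ) (steadyState y₀ θ) (eigvec y₀ θ i) =
      eigval y₀ i • eigvec y₀ θ i) ∧
    -- the stable manifold: for arbitrarily small neighbourhoods `U` of `P₁`,
    ∀ N ∈ 𝓝 (steadyState y₀ θ), ∃ U ⊆ N, IsOpen U ∧ steadyState y₀ θ ∈ U ∧
      -- it is the increasing union of the sets `stableSetFrom y₀ θ U T`, `T ≥ 0`,
      stableSet y₀ θ = ⋃ T ∈ Ici (0 : ℝ), stableSetFrom y₀ θ U T ∧
      -- each of which is relatively open in the larger ones,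
      (∀ T T' : ℝ, 0 ≤ T → T ≤ T' → ∃ O : Set (Fin 4 → ℝ), IsOpen O ∧
        stableSetFrom y₀ θ U T = stableSetFrom y₀ θ U T' ∩ O) ∧
      -- and is a three-dimensional embedded submanifold through `P₁`
      -- whose tangent space at `P₁` is the span of the three stable eigenvectors
      ∀ T : ℝ, 0 ≤ T →
        IsSmoothSubmanifold 3 (stableSetFrom y₀ θ U T) ∧
        steadyState y₀ θ ∈ stableSetFrom y₀ θ U T ∧
        (y₀ ≠ 1 / √5 → tangentVectors (stableSetFrom y₀ θ U T) (steadyState y₀ θ) =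
          (Submodule.span ℝ {eigvec y₀ θ 0, eigvec y₀ θ 1, eigvec y₀ θ 2} :
            Submodule ℝ (Fin 4 → ℝ))) ∧
        (y₀ = 1 / √5 → tangentVectors (stableSetFrom y₀ θ U T) (steadyState y₀ θ) =
          (Submodule.span ℝ {eigvec y₀ θ 0, eigvec y₀ θ 1, resonantVec y₀ θ} :
            Submodule ℝ (Fin 4 → ℝ))) := by
  have hr := rate_pos hy₀ hy₀'
  have hr1 := one_lt_rate hy₀ hy₀'
  have he := eigval_zero_le hy₀ hy₀'
  have hmem := steadyState_mem_phaseDomain hy₀ hy₀' θ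
  have hf := contDiffOn_reducedField hy₀ θ
  have hV := isOpen_phaseDomain y₀
  have hfp := reducedField_steadyState hy₀ hy₀' hθ
  have h1 : eigval y₀ 1 = -2 := rfl
  have h2 : eigval y₀ 2 = -rate y₀ := rfl
  have h3 : eigval y₀ 3 = rate y₀ := rfl
  refine ⟨(reducedSystem_iff hy₀ (by linarith) _ _).2 ⟨hmem, hfp.symm⟩,
    isHyperbolicSaddle_steadyState hy₀ hy₀' hθ, charpoly_fderiv_reducedField hy₀ hy₀' hθ,
    by linarith, by linarith, by linarith, by linarith, fderiv_eigvec hy₀ hy₀' hθ, fun N hN => ?_⟩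
  obtain ⟨U, hUN, hU, hpU, hM⟩ := exists_isSmoothSubmanifold_stableSetIn (n := 4) (k := 3)
    (by norm_num) hV hmem hf hfp (nearEigenbasisEquiv hy₀ hy₀' hθ) (l := eigval y₀) (μ := 1)
    (fun i => by
      fin_cases i
      · simp only [Fin.zero_eta]; constructor <;> intro <;> [norm_num; linarith]
      · simp only [Fin.mk_one]; constructor <;> intro <;> [norm_num; linarith]
      · simp only [Fin.reduceFinMk]; constructor <;> intro <;> [norm_num; linarith]
      · simp only [Fin.reduceFinMk]
        exact iff_of_false (by linarith) (by norm_num))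
    (fun i => by
      fin_cases i
      · exact le_abs.2 (.inr (by simp only [Fin.zero_eta]; linarith))
      · exact le_abs.2 (.inr (by simp only [Fin.mk_one]; linarith))
      · exact le_abs.2 (.inr (by simp only [Fin.reduceFinMk]; linarith))
      · exact le_abs.2 (.inl (by simp only [Fin.reduceFinMk]; linarith)))
    norm_offDiagonal_lt
    (fun z i hi => by
      rw [offDiagonal_apply]
      fin_cases i <;> simp_all)
    (fderiv_nearEigenbasis hy₀ hy₀' hθ) hN
  simp only [stableSetFrom_eq hy₀ hy₀']
  refine ⟨U, hUN, hU, hpU, Subset.antisymm ?_ ?_, fun T T' hT hTT' =>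
    exists_isOpen_stableSetIn_eq_inter hV hf hU hT hTT', fun T hT => ?_⟩
  · rintro x ⟨γ, hγ, rfl, hlim⟩
    obtain ⟨T, hT, hx⟩ := exists_mem_stableSetIn (hU.mem_nhds hpU)
      ((isForwardSolution_iff hy₀ hy₀').1 hγ) hlim
    exact mem_biUnion (mem_Ici.2 hT) hx
  · refine iUnion₂_subset fun T _ => ?_
    rintro x ⟨γ, hγ, hx, hlim, -⟩
    exact ⟨γ, (isForwardSolution_iff hy₀ hy₀').2 hγ, hx, hlim⟩
  · obtain ⟨hs, hp, ht⟩ := hM T hT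
    rw [image_coordSubspace hy₀ hy₀' hθ] at ht
    exact ⟨hs, hp, fun hne => by rw [ht, span_eigvec_eq hy₀ hy₀' hθ hne], fun _ => ht⟩
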